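/- **Setting (weighted Indian buffet process).** Let $\mathcal X$ be a separable metric space with Borel $\sigma$-field $\mathcal B$, $m$ a diffuse probability measure on $\mathcal B$ (that is, $m\{x\}=0$ for all $x$), and $\alpha>0$, $\beta\in[0,1)$, $c>-\beta$ real numbers. A random measure is a measurable map from a probability space to the finite measures on $\mathcal B$, whose $\sigma$-field is generated by $\mu\mapsto\mu(B)$, $B\in\mathcal B$. For a finite measure $\nu$ on $\mathcal B$ with diffuse part $\nu_c$ and atoms $x_1,x_2,\dots$ of masses $\gamma_j=\nu\{x_j\}\le 1$, let $\mathrm{BeP}(\nu)$ denote the law of the random measure $M'+M''$, where $M'$ and $M''$ are independent, $M'$ is a Poisson random measure with intensity $\nu_c$, and $M''=\sum_j V_j\delta_{x_j}$ with independent indicators $V_j$ such that $P(V_j=1)=\gamma_j$. Let $(M_n)_{n\ge1}$ be random measures on $\mathcal X$ and $(R_n)_{n\ge1}$ real random variables, defined on a probability space $(\Omega,\mathcal A,P)$, and for $n\ge 0$ put $\mathcal F_n=\sigma(M_1,\dots,M_n,R_1,\dots,R_n)$ ($\mathcal F_0$ is trivial), $S_n=\{x\in\mathcal X: M_i\{x\}=1\text{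 for some }i=1,\dots,n\}$, and $$\nu_n=\sum_{x\in S_n}\frac{\sum_{i=1}^nR_iM_i\{x\}-\beta}{\sum_{i=1}^nR_i+c}\,\delta_x+\Lambda_n\,m,\qquad \Lambda_n=\alpha\,\frac{\Gamma(c+1)\,\Gamma(c+\beta+\sum_{i=1}^nR_i)}{\Gamma(c+\beta)\,\Gamma(c+1+\sum_{i=1}^nR_i)}$$ (so $\Lambda_0=\alpha$ and $\nu_0=\alpha m$). Assume that: * for each $n\ge1$, $R_n$ is independent of $(M_1,\dots,M_n,R_1,\dots,R_{n-1})$; * there is a constant $u>\max(\beta,0)$ such that $R_n\ge u$ a.s. for all $n\ge1$; * for each $n\ge0$, the conditional law of $M_{n+1}$ given $\mathcal F_n$ is $\mathrm{BeP}(\nu_n)$. Let $L_n=\operatorname{card}(S_n)$ be the number of distinct dishes tried by the first $n$ customers ($S_n$ is a.s. finite), and $\overline R_n=\frac1n\sum_{i=1}^nR_i$. Let $a_n(\beta)=\log n$ if $\beta=0$ and $a_n(\beta)=n^\beta$ if $\beta\in(0,1)$. For a constant $r$, let $$\lambda(\beta)=\frac{\alpha c}{r}\ \text{ if }\beta=0,\qquad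 \lambda(\beta)=\frac{\alpha\,\Gamma(c+1)}{\Gamma(c+\beta)}\,\frac{1}{\beta\,r^{1-\beta}}\ \text{ if }\beta\in(0,1).$$ **Theorem.** If, for some constant $r$, $$\overline R_n\longrightarrow r\ \text{ a.s.}\qquad\text{and}\qquad \frac{\sum_{j=1}^nj^{\beta-1}\,E|\overline R_j-r|}{\sqrt{a_n(\beta)}}\longrightarrow0\qquad(n\to\infty),$$ then $$\sqrt{a_n(\beta)}\left\{\frac{L_n}{a_n(\beta)}-\lambda(\beta)\right\}\longrightarrow\mathcal N\bigl(0,\lambda(\beta)\bigr)\quad\text{stably}.$$ Here $X_n\to\mathcal N(0,\lambda)$ stably, for real random variables $X_n$, means that $\lim_n E\{f(X_n)\mid H\}=\int f\,d\mathcal N(0,\lambda)$ for every $H\in\mathcal A$ with $P(H)>0$ and every bounded continuous $f:\mathbb R\to\mathbb R$, where $\mathcal N(0,\lambda)$ is the Gaussian law with mean $0$ and variance $\lambda$. -/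

import Mathlib

open MeasureTheory ProbabilityTheory Filter Topology
open scoped ENNReal NNReal BoundedContinuousFunction

noncomputable section

namespace WeightedIBP

/-! ### Stable convergence -/

/-- `X n` converges stably to the random probability measure `K`: for every event `H` of positive
probability and every bounded continuous `f`, `E{f(X n) | H} → E{K(f) | H}`. As part of the notion,
the `X n` are random variables (almost everywhere measurable). -/
structure ConvergesStably {Ω E : Type*} [MeasurableSpace Ω] [TopologicalSpace E]
    [MeasurableSpace E] (P : Measure Ω) (X : ℕ → Ω → E) (K : Kernel Ω E) [IsMarkovKernel K] :
    Prop where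
  aemeasurable : ∀ n, AEMeasurable (X n) P
  tendsto : ∀ H : Set Ω, MeasurableSet H → 0 < P H → ∀ f : E →ᵇ ℝ,
    Tendsto (fun n => ∫ ω, f (X n ω) ∂(cond P H)) atTop
      (𝓝 (∫ ω, ∫ y, f y ∂(K ω) ∂(cond P H)))

/-! ### Poisson and Bernoulli random measures

Laws of random measures are measures on `Measure 𝓧`, whose `σ`-field is generated by the
evaluations `μ ↦ μ B`, `B` measurable. -/

section RandomMeasure

variable {𝓧 : Type*} [MeasurableSpace 𝓧]

/-- The law of a Poisson random measure with finite intensity `ν`, i.e. of `∑_{j < N} δ_{X_j}` with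
`N` Poisson of mean `ν(𝓧)`, and `X_j` i.i.d. of law `ν / ν(𝓧)` and independent of `N`
(the point mass at the zero measure if `ν = 0`). -/
def poissonLaw (ν : Measure 𝓧) : Measure (Measure 𝓧) :=
  (poissonMeasure (ν Set.univ).toNNReal).bind fun k =>
    (Measure.pi fun _ : Fin k => (ν Set.univ)⁻¹ • ν).map fun x => ∑ j, Measure.dirac (x j)

/-- The set of atoms of `ν`. -/
def atoms (ν : Measure 𝓧) : Set 𝓧 := {x | ν {x} ≠ 0}

/-- The law of `∑ V_x δ_x`, the sum being over the atoms `x` of `ν`, where the `V_x` are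
independent indicators with `P(V_x = 1) = ν {x}`. -/
def atomicLaw (ν : Measure 𝓧) : Measure (Measure 𝓧) :=
  (Measure.infinitePi fun x : atoms ν =>
      ν {(x : 𝓧)} • Measure.dirac (1 : ℝ≥0∞) + (1 - ν {(x : 𝓧)}) • Measure.dirac (0 : ℝ≥0∞)).map
    fun V => Measure.sum fun x : atoms ν => V x • Measure.dirac (x : 𝓧)

/-- `BeP(ν)`, the law of a Bernoulli random measure with hazard measure `ν` (a finite measure all of
whose atoms have mass at most `1`): the law of `M₁ + M₂` with `M₁` and `M₂` independent, `M₁` a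
Poisson random measure whose intensity is the diffuse part of `ν`, and `M₂ = ∑ V_x δ_x` the
independent thinning of the atoms of `ν`. -/
def bernoulliLaw (ν : Measure 𝓧) : Measure (Measure 𝓧) :=
  ((poissonLaw (ν.restrict (atoms ν)ᶜ)).prod (atomicLaw ν)).map fun μ => μ.1 + μ.2

end RandomMeasure

/-! ### The weighted Indian buffet process

Customers are numbered from `0`: `M i` and `R i` belong to customer number `i + 1`, so that "the
first `n` customers" are those with index `i < n`. -/

section Model

variable {Ω 𝓧 : Type*}

/-- `∑_{i ≤ n} R_i`. -/
def totalWeight (R : ℕ → Ω → ℝ) (n : ℕ) (ω : Ω) : ℝ := ∑ i ∈ Finset.range n, R i ω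

/-- `R̄_n`, the average weight of the first `n` customers. -/
def meanWeight (R : ℕ → Ω → ℝ) (n : ℕ) (ω : Ω) : ℝ := totalWeight R n ω / n

variable [MeasurableSpace 𝓧]

/-- `S_n`, the set of dishes tried by the first `n` customers. -/
def dishes (M : ℕ → Ω → Measure 𝓧) (n : ℕ) (ω : Ω) : Set 𝓧 := {x | ∃ i < n, M i ω {x} = 1}

/-- `L_n`, the number of distinct dishes tried by the first `n` customers
(`S_n` is almost surely finite in the model). -/
def numDishes (M : ℕ → Ω → Measure 𝓧) (n : ℕ) (ω : Ω) : ℕ := (dishes M n ω).ncard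

/-- `ℱ_n = σ(M_1, …, M_n, R_1, …, R_n)`; in particular `ℱ_0` is trivial. -/
abbrev history (M : ℕ → Ω → Measure 𝓧) (R : ℕ → Ω → ℝ) (n : ℕ) : MeasurableSpace Ω :=
  ⨆ i ∈ Finset.range n, MeasurableSpace.comap (M i) inferInstance ⊔
    MeasurableSpace.comap (R i) inferInstance

/-- `Λ_n`, the mean number of new dishes of customer `n + 1` given the past; `Λ_0 = α`. -/
def newDishRate (α β c : ℝ) (R : ℕ → Ω → ℝ) (n : ℕ) (ω : Ω) : ℝ :=
  α * (Real.Gamma (c + 1) * Real.Gamma (c + β + totalWeight R n ω)) /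
    (Real.Gamma (c + β) * Real.Gamma (c + 1 + totalWeight R n ω))

/-- The conditional probability that customer `n + 1` tries the old dish `x`. -/
def inclusionProb (β c : ℝ) (M : ℕ → Ω → Measure 𝓧) (R : ℕ → Ω → ℝ) (n : ℕ) (ω : Ω) (x : 𝓧) :
    ℝ :=
  (∑ i ∈ Finset.range n, R i ω * (M i ω).real {x} - β) / (totalWeight R n ω + c)

/-- The random hazard measure
`ν_n = ∑_{x ∈ S_n} (∑_{i ≤ n} R_i M_i{x} - β) / (∑_{i ≤ n} R_i + c) δ_x + Λ_n m`. -/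
def hazard (m : Measure 𝓧) (α β c : ℝ) (M : ℕ → Ω → Measure 𝓧) (R : ℕ → Ω → ℝ)
    (n : ℕ) (ω : Ω) : Measure 𝓧 :=
  (Measure.sum fun x : dishes M n ω =>
      ENNReal.ofReal (inclusionProb β c M R n ω (x : 𝓧)) • Measure.dirac (x : 𝓧)) +
    ENNReal.ofReal (newDishRate α β c R n ω) • m

/-- `((M_n, R_n))` is a weighted Indian buffet process with parameters `m, α, β, c` on the
probability space `(Ω, P)`. -/
structure IsWeightedIBP [MeasurableSpace Ω] (P : Measure Ω) (m : Measure 𝓧) (α β c : ℝ)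
    (M : ℕ → Ω → Measure 𝓧) (R : ℕ → Ω → ℝ) : Prop where
  /-- each `M_n` is a random measure with values in the finite measures -/
  isFiniteMeasure : ∀ n ω, IsFiniteMeasure (M n ω)
  measurable_measure : ∀ n, Measurable (M n)
  measurable_weight : ∀ n, Measurable (R n)
  /-- `R_n` is independent of `(M_1, …, M_n, R_1, …, R_{n-1})` -/
  indep : ∀ n, Indep (MeasurableSpace.comap (R n) inferInstance)
    (history M R n ⊔ MeasurableSpace.comap (M n) inferInstance) P
  /-- the weights are bounded below by a constant `u > max β 0` -/
  lower_bound : ∃ u : ℝ, max β 0 < u ∧ ∀ n, ∀ᵐ ω ∂P, u ≤ R n ω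
  /-- conditionally on `ℱ_n`, the law of `M_{n+1}` is `BeP(ν_n)` -/
  condLaw : ∀ n, ∀ A : Set (Measure 𝓧), MeasurableSet A →
    P[(M n ⁻¹' A).indicator (fun _ => (1 : ℝ)) | history M R n] =ᵐ[P]
      fun ω => (bernoulliLaw (hazard m α β c M R n ω)).real A

end Model

/-! ### Normalising constants -/

/-- `a_n(β)`: `log n` if `β = 0` and `n ^ β` otherwise. -/
def growth (β : ℝ) (n : ℕ) : ℝ := if β = 0 then Real.log n else (n : ℝ) ^ β

/-- `λ(β)`: `α c / r` if `β = 0`, and `α Γ(c+1) / Γ(c+β) · 1 / (β r^{1-β})` otherwise. -/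
def limitRate (α β c r : ℝ) : ℝ :=
  if β = 0 then α * c / r
  else α * Real.Gamma (c + 1) / Real.Gamma (c + β) * (1 / (β * r ^ (1 - β)))

end WeightedIBP

end

noncomputable section

namespace WeightedIBP

open MeasurableSpace

/-! ### Refining countable partitions separating points. -/

section Partition

variable {𝓧 : Type*} [MeasurableSpace 𝓧] [CountablyGenerated 𝓧]

/-! Only the new dishes matter. Given the past, customer `k + 1` picks old dishes through the atomic
part of `BeP(ν_k)` and new ones through its Poisson part, whose intensity `Λ_k m` is diffuse. Hence
the number `N_k` of new dishes is conditionally Poisson of mean `Λ_k`, and `L_n` is the sum of the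
`N_k`, `k < n` (`integral_cexp_newDishes`, `numDishes_eq_sum`). The hypothesis gives conditional
probabilities only for fixed events, whereas the set of new dishes is random. It is therefore
approximated from inside by unions of cells of a countable partition that miss all old dishes; such
a union takes finitely many values, each on an event of the past.

Write `A_n` for the sum of the `Λ_k`, `k < n`. Then `W_n(s) = exp(i s L_n - (e^{is} - 1) A_n)` is a
martingale, so for `Y` known at time `k` and `s_n → 0` the mean of `Y W_n(s_n)` equals that of `Y
W_k(s_n)` and tends to that of `Y`. With `s_n = t / √a_n`, the variable `exp(i t X_n)` is `W_n(s_n)`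
times a factor that is close in `L¹` to `exp(-λ t² / 2)`, provided `E|A_n - λ a_n| = o(√a_n)`
(`tendsto_integral_mul_cexp`). An arbitrary event `H` is handled by approximating its indicator by
conditional expectations (`tendsto_setIntegral_cexp`), which yields stability.

The condition on `A_n` is deterministic analysis: `Γ(b + x) / Γ(b + s + x) = x^{-s} + O(x^{-s-1})`
turns `Λ_j` into a multiple of `j^{β-1} R̄_j^{β-1}` up to a summable error, and replacing `R̄_j` by
`r` costs at most a constant times the sum in the hypothesis (`exists_abs_sum_dishRate_sub_le`). -/

lemma countablePartitionSet_succ_subset (j : ℕ) (x : 𝓧) :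
    countablePartitionSet (j + 1) x ⊆ countablePartitionSet j x := by
  obtain ⟨S, hS, h⟩ := (measurableSet_generateFrom_countablePartition_iff (j + 1) _).1
    (measurableSet_succ_countablePartition j (countablePartitionSet_mem j x))
  have hx := mem_countablePartitionSet j x
  rw [h] at hx
  obtain ⟨s, hs, hxs⟩ := hx
  rw [countablePartitionSet_of_mem (hS hs) hxs, h]
  exact Set.subset_sUnion_of_mem hs

lemma countablePartitionSet_antitone (x : 𝓧) :
    Antitone fun j => countablePartitionSet j x :=
  antitone_nat_of_succ_le fun j => countablePartitionSet_succ_subset j x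

lemma iInter_countablePartitionSet [MeasurableSingletonClass 𝓧] (x : 𝓧) :
    ⋂ j, countablePartitionSet j x = {x} := by
  refine Set.Subset.antisymm (fun y hy => ?_) ?_
  · rw [Set.mem_iInter] at hy
    -- Points lying in the same cell at every level cannot be told apart by the generated σ-field,
    -- which contains `{x}`.
    have key : ∀ A : Set 𝓧, MeasurableSet A → (x ∈ A ↔ y ∈ A) := by
      intro A hA
      have hA' : MeasurableSet[generateFrom (⋃ n, countablePartition 𝓧 n)] A := by
        rwa [generateFrom_iUnion_countablePartition]
      induction A, hA' using generateFrom_induction with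
      | hC t ht _ =>
        obtain ⟨n, hn⟩ := Set.mem_iUnion.1 ht
        rw [← countablePartitionSet_eq_iff x hn, ← countablePartitionSet_eq_iff y hn,
          countablePartitionSet_of_mem (countablePartitionSet_mem n x) (hy n)]
      | empty => simp
      | compl t ht ih =>
        have := ih (by rw [generateFrom_iUnion_countablePartition] at ht; exact ht)
        simp [this]
      | iUnion s hs ih =>
        have := fun n => ih n (by
          have := hs n
          rw [generateFrom_iUnion_countablePartition] at this; exact this)
        simp [this]
    exact (key {x} (measurableSet_singleton x)).1 rfl
  · simp [mem_countablePartitionSet]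

lemma exists_forall_countablePartitionSet_inter_eq [MeasurableSingletonClass 𝓧]
    {F : Set 𝓧} (hF : F.Finite) (x : 𝓧) :
    ∃ j₀, ∀ j ≥ j₀, countablePartitionSet j x ∩ F ⊆ {x} := by
  have h1 : ∀ y ∈ F, ∀ᶠ j in atTop, y ∈ countablePartitionSet j x → y = x := by
    intro y _
    by_cases hyx : y = x
    · simp [hyx]
    · have : y ∉ ⋂ j, countablePartitionSet j x := by
        rw [iInter_countablePartitionSet]; exact hyx
      rw [Set.mem_iInter] at this
      push Not at this
      obtain ⟨j, hj⟩ := this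
      filter_upwards [eventually_ge_atTop j] with i hi h
      exact absurd (countablePartitionSet_antitone x hi h) hj
  obtain ⟨j₀, h⟩ := eventually_atTop.1 ((hF.eventually_all).2 h1)
  exact ⟨j₀, fun j hj y hy => h j hj y hy.2 hy.1⟩

end Partition

/-! ### Simple point measures form a measurable set. -/

section Simple

variable {𝓧 : Type*} [MeasurableSpace 𝓧]

/-- `μ` is a finite sum of Dirac masses at distinct points. -/
def IsSimplePoint (μ : Measure 𝓧) : Prop := ∃ F : Finset 𝓧, μ = ∑ x ∈ F, Measure.dirac x

lemma sum_dirac_apply (F : Finset 𝓧) {B : Set 𝓧} (hB : MeasurableSet B) :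
    (∑ x ∈ F, Measure.dirac x) B = ((F : Set 𝓧) ∩ B).ncard := by
  classical
  rw [Measure.finsetSum_apply]
  simp only [Measure.dirac_apply' _ hB, Set.indicator_apply, Pi.one_apply]
  rw [Finset.sum_ite, Finset.sum_const_zero, add_zero, Finset.sum_const, nsmul_one,
    ← Set.ncard_coe_finset]
  congr 2
  ext x
  simp

lemma sum_dirac_singleton [MeasurableSingletonClass 𝓧] (F : Finset 𝓧) (x : 𝓧) [Decidable (x ∈ F)] :
    (∑ x ∈ F, Measure.dirac x) {x} = if x ∈ F then 1 else 0 := by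
  rw [sum_dirac_apply F (measurableSet_singleton x)]
  split_ifs with h
  · rw [Set.inter_eq_self_of_subset_right (by simpa using h)]; simp
  · have : (F : Set 𝓧) ∩ {x} = ∅ := by ext y; simp; rintro hy rfl; exact h hy
    simp [this]

lemma isSimplePoint_sum_dirac_of_injective [MeasurableSingletonClass 𝓧] {k : ℕ} {x : Fin k → 𝓧}
    (hx : Function.Injective x) : IsSimplePoint (∑ j, Measure.dirac (x j)) := by
  classical
  exact ⟨Finset.univ.map ⟨x, hx⟩, by simp⟩

/-- Carried by complementary sets, the two measures have no common atom, so no point acquires mass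
`2`. -/
lemma IsSimplePoint.add [MeasurableSingletonClass 𝓧] {μ ν : Measure 𝓧} (hμ : IsSimplePoint μ) (hν : IsSimplePoint ν)
    {S : Set 𝓧} (hμS : μ S = 0) (hνS : ν Sᶜ = 0) : IsSimplePoint (μ + ν) := by
  classical
  obtain ⟨F, rfl⟩ := hμ
  obtain ⟨G, rfl⟩ := hν
  refine ⟨F ∪ G, ?_⟩
  rw [Finset.sum_union]
  rw [Finset.disjoint_left]
  intro x hxF hxG
  by_cases hx : x ∈ S
  · have := measure_mono_null (Set.singleton_subset_iff.2 hx) hμS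
    rw [sum_dirac_singleton, if_pos hxF] at this
    simp at this
  · have := measure_mono_null (Set.singleton_subset_iff.2 hx) hνS
    rw [sum_dirac_singleton, if_pos hxG] at this
    simp at this

variable [CountablyGenerated 𝓧] [MeasurableSingletonClass 𝓧]

/-- The right-hand side involves countably many evaluations, which makes simplicity a measurable
property. Once the partition separates the finitely many points, each cell holds at most one. -/
lemma isSimplePoint_iff (μ : Measure 𝓧) : IsSimplePoint μ ↔
    ∃ j₀, ∀ j ≥ j₀, ∀ B ∈ countablePartition 𝓧 j, μ B = 0 ∨ μ B = 1 := by
  classical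
  constructor
  · rintro ⟨F, rfl⟩
    choose j hj using fun x : 𝓧 => exists_forall_countablePartitionSet_inter_eq F.finite_toSet x
    refine ⟨F.sup j, fun i hi B hB => ?_⟩
    rw [sum_dirac_apply F (measurableSet_countablePartition i hB)]
    rcases Set.eq_empty_or_nonempty ((F : Set 𝓧) ∩ B) with h | ⟨x, hxF, hxB⟩
    · simp [h]
    · right
      have h1 := hj x i ((Finset.le_sup hxF).trans hi)
      rw [countablePartitionSet_of_mem hB hxB] at h1
      have : (F : Set 𝓧) ∩ B = {x} :=
        Set.Subset.antisymm (by rwa [Set.inter_comm]) (by simp [hxB]; exact hxF)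
      simp [this]
  · rintro ⟨j₀, h⟩
    have hfin : μ Set.univ < ∞ := by
      rw [← sUnion_countablePartition 𝓧 j₀, Set.sUnion_eq_biUnion]
      refine measure_biUnion_lt_top (finite_countablePartition 𝓧 j₀) fun B hB => ?_
      rcases h j₀ le_rfl B hB with h | h <;> simp [h]
    have : IsFiniteMeasure μ := ⟨hfin⟩
    -- The null cells form a null set. A point outside it has cells of mass one shrinking to it,
    -- hence is an atom of mass one; finiteness of `μ` leaves finitely many such points.
    set N : Set 𝓧 := ⋃ j ≥ j₀, ⋃ B ∈ {B ∈ countablePartition 𝓧 j | μ B = 0}, B with hN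
    have hN0 : μ N = 0 := by
      simp only [hN]
      refine measure_iUnion_null fun j => measure_iUnion_null fun hj => ?_
      refine (measure_biUnion_null_iff ((finite_countablePartition 𝓧 j).subset
        (Set.sep_subset _ _)).countable).2 ?_
      exact fun B hB => hB.2
    have hone : ∀ x ∈ Nᶜ, μ {x} = 1 := by
      intro x hx
      have hc : ∀ j ≥ j₀, μ (countablePartitionSet j x) = 1 := by
        intro j hj
        refine (h j hj _ (countablePartitionSet_mem j x)).resolve_left fun h0 => hx ?_
        simp only [hN, Set.mem_iUnion]
        exact ⟨j, hj, _, ⟨countablePartitionSet_mem j x, h0⟩, mem_countablePartitionSet j x⟩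
      have ht := tendsto_measure_iInter_atTop (μ := μ)
        (fun j => (measurableSet_countablePartitionSet j x).nullMeasurableSet)
        (countablePartitionSet_antitone x) ⟨0, measure_ne_top _ _⟩
      rw [iInter_countablePartitionSet] at ht
      refine tendsto_nhds_unique ht (tendsto_const_nhds.congr' ?_)
      filter_upwards [eventually_ge_atTop j₀] with j hj
      exact (hc j hj).symm
    have hNfin : (Nᶜ).Finite := by
      have := Measure.finite_const_le_meas_of_disjoint_iUnion μ (ε := 1) one_pos
        (As := fun x : (Nᶜ : Set 𝓧) => ({(x : 𝓧)} : Set 𝓧)) (fun _ => measurableSet_singleton _)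
        (fun x y hxy => by simpa using fun h => hxy (Subtype.ext h)) (measure_ne_top _ _)
      have h2 : {i : (Nᶜ : Set 𝓧) | (1 : ℝ≥0∞) ≤ μ {(i : 𝓧)}} = Set.univ := by
        ext x; simp [hone x x.2]
      rw [h2] at this
      exact Set.finite_coe_iff.1 (Set.finite_univ_iff.1 this)
    refine ⟨hNfin.toFinset, Measure.ext fun B hB => ?_⟩
    have h1 : μ B = μ (Nᶜ ∩ B) := by
      refine le_antisymm ?_ (measure_mono Set.inter_subset_right)
      calc μ B ≤ μ (N ∪ (Nᶜ ∩ B)) := measure_mono fun x hx => by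
            by_cases hxN : x ∈ N
            · exact Or.inl hxN
            · exact Or.inr ⟨hxN, hx⟩
        _ ≤ μ N + μ (Nᶜ ∩ B) := measure_union_le _ _
        _ = _ := by rw [hN0, zero_add]
    rw [sum_dirac_apply _ hB, h1, Set.Finite.coe_toFinset]
    have hfi : (Nᶜ ∩ B).Finite := hNfin.inter_of_left B
    rw [← hfi.coe_toFinset, ← sum_measure_singleton, Set.ncard_coe_finset]
    rw [Finset.sum_congr rfl (g := fun _ => 1)]
    · simp
    · intro x hx
      exact hone x ((Set.Finite.mem_toFinset hfi).1 hx).1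

lemma measurableSet_isSimplePoint : MeasurableSet {μ : Measure 𝓧 | IsSimplePoint μ} := by
  simp only [isSimplePoint_iff, Set.ofPred_exists, Set.ofPred_forall]
  refine .iUnion fun j₀ => .iInter fun j => .iInter fun _ =>
    .biInter (finite_countablePartition 𝓧 j).countable fun B hB => ?_
  have hm := Measure.measurable_coe (measurableSet_countablePartition j hB)
  exact (hm (measurableSet_singleton 0)).union (hm (measurableSet_singleton 1))

end Simple

/-! ### Poisson random measures with diffuse intensity. -/

section Poisson

variable {𝓧 : Type*} [MeasurableSpace 𝓧]

lemma measurable_sum_dirac (k : ℕ) :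
    Measurable fun x : Fin k → 𝓧 => ∑ j, Measure.dirac (x j) :=
  Finset.measurable_fun_sum _ fun j _ => Measure.measurable_dirac.comp (measurable_pi_apply j)

lemma measurableSet_diagonal_of_countablyGenerated [CountablyGenerated 𝓧]
    [MeasurableSingletonClass 𝓧] : MeasurableSet (Set.diagonal 𝓧) := by
  have : Set.diagonal 𝓧 = ⋂ j, ⋃ B ∈ countablePartition 𝓧 j, B ×ˢ B := by
    ext ⟨x, y⟩
    simp only [Set.mem_diagonal_iff, Set.mem_iInter, Set.mem_iUnion, Set.mem_prod]
    constructor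
    · rintro rfl j
      exact ⟨_, countablePartitionSet_mem j x, mem_countablePartitionSet j x,
        mem_countablePartitionSet j x⟩
    · intro h
      have : y ∈ ⋂ j, countablePartitionSet j x := by
        refine Set.mem_iInter.2 fun j => ?_
        obtain ⟨B, hB, hx, hy⟩ := h j
        rwa [countablePartitionSet_of_mem hB hx]
      rw [iInter_countablePartitionSet] at this
      exact (Set.mem_singleton_iff.1 this).symm
  rw [this]
  exact .iInter fun j => .biUnion (finite_countablePartition 𝓧 j).countable fun B hB =>
    (measurableSet_countablePartition j hB).prod (measurableSet_countablePartition j hB)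

/-- By Fubini the diagonal is null for `m.prod m`, its slices being singletons, so independent
points of diffuse law almost surely do not collide. -/
lemma ae_pi_injective [CountablyGenerated 𝓧] [MeasurableSingletonClass 𝓧]
    (m : Measure 𝓧) [IsProbabilityMeasure m] (hm : ∀ x, m {x} = 0) (k : ℕ) :
    ∀ᵐ x ∂(Measure.pi fun _ : Fin k => m), Function.Injective x := by
  have h : ∀ i j : Fin k, i ≠ j → ∀ᵐ x ∂(Measure.pi fun _ : Fin k => m), x i ≠ x j := by
    intro i j hij
    have hind : iIndepFun (fun (i : Fin k) (x : Fin k → 𝓧) => x i)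
        (Measure.pi fun _ : Fin k => m) :=
      iIndepFun_pi (X := fun (_ : Fin k) (x : 𝓧) => x) fun _ => aemeasurable_id
    have hmap := (hind.indepFun hij).map_prod_eq_prod_map_map
      (measurable_pi_apply i).aemeasurable (measurable_pi_apply j).aemeasurable
    have hev : ∀ i, Measure.map (fun x : Fin k → 𝓧 => x i) (Measure.pi fun _ : Fin k => m) = m :=
      fun i => (measurePreserving_eval (fun _ : Fin k => m) i).map_eq
    rw [hev i, hev j] at hmap
    have hd : m.prod m (Set.diagonal 𝓧) = 0 := by
      rw [Measure.prod_apply measurableSet_diagonal_of_countablyGenerated]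
      have : ∀ x : 𝓧, Prod.mk x ⁻¹' Set.diagonal 𝓧 = {x} := by
        intro x; ext y; simp [eq_comm]
      simp [this, hm]
    rw [← hmap, Measure.map_apply (by fun_prop) measurableSet_diagonal_of_countablyGenerated] at hd
    rw [ae_iff]
    convert hd using 2
    ext x; simp
  filter_upwards [ae_all_iff.2 fun i => ae_all_iff.2 fun j => eventually_imp_distrib_left.2 (h i j)]
    with x hx i j hij
  by_contra hne
  exact hx i j hne hij

lemma ae_pi_sum_dirac [CountablyGenerated 𝓧] [MeasurableSingletonClass 𝓧]
    (m : Measure 𝓧) [IsProbabilityMeasure m] (hm : ∀ x, m {x} = 0) {S : Set 𝓧}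
    (hS : S.Finite) (k : ℕ) :
    ∀ᵐ x ∂(Measure.pi fun _ : Fin k => m),
      IsSimplePoint (∑ j, Measure.dirac (x j)) ∧ (∑ j, Measure.dirac (x j)) S = 0 := by
  have hS0 : ∀ᵐ y ∂m, y ∉ S := by
    rw [ae_iff]
    simpa using measure_biUnion_null_iff hS.countable |>.2 fun x _ => hm x
  have h1 : ∀ j : Fin k, ∀ᵐ x ∂(Measure.pi fun _ : Fin k => m), x j ∉ S := fun j =>
    (measurePreserving_eval (fun _ : Fin k => m) j).quasiMeasurePreserving.ae hS0
  filter_upwards [ae_pi_injective m hm k, ae_all_iff.2 h1] with x hx hxS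
  refine ⟨isSimplePoint_sum_dirac_of_injective hx, ?_⟩
  rw [Measure.finsetSum_apply]
  refine Finset.sum_eq_zero fun j _ => ?_
  rw [Measure.dirac_apply' _ hS.measurableSet]
  simp [hxS j]

lemma inv_smul_ofReal_smul {Λ : ℝ} (hΛ : 0 < Λ) (m : Measure 𝓧) [IsProbabilityMeasure m] :
    ((ENNReal.ofReal Λ • m) Set.univ)⁻¹ • (ENNReal.ofReal Λ • m) = m := by
  rw [Measure.smul_apply, measure_univ, smul_eq_mul, mul_one, smul_smul,
    ENNReal.inv_mul_cancel (by simpa using hΛ) ENNReal.ofReal_ne_top, one_smul]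

lemma poissonLaw_eq_sum {Λ : ℝ} (hΛ : 0 < Λ) (m : Measure 𝓧) [IsProbabilityMeasure m] :
    poissonLaw (ENNReal.ofReal Λ • m) = Measure.sum fun k : ℕ =>
      ENNReal.ofReal (Real.exp (-Λ) * Λ ^ k / k.factorial) •
        (Measure.pi fun _ : Fin k => m).map fun x => ∑ j, Measure.dirac (x j) := by
  unfold poissonLaw
  rw [inv_smul_ofReal_smul hΛ, Measure.smul_apply, measure_univ, smul_eq_mul, mul_one,
    poissonMeasure, Measure.bind_sum _ _ (Measurable.of_discrete.aemeasurable)]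
  congr 1
  ext1 k
  rw [Measure.bind_smul, Measure.dirac_bind Measurable.of_discrete]
  have h : ((ENNReal.ofReal Λ).toNNReal : ℝ) = Λ := ENNReal.toReal_ofReal hΛ.le
  rw [h]

lemma isProbabilityMeasure_poissonLaw {Λ : ℝ} (hΛ : 0 < Λ) (m : Measure 𝓧)
    [IsProbabilityMeasure m] : IsProbabilityMeasure (poissonLaw (ENNReal.ofReal Λ • m)) := by
  unfold poissonLaw
  rw [inv_smul_ofReal_smul hΛ]
  constructor
  rw [Measure.bind_apply .univ Measurable.of_discrete.aemeasurable]
  have : ∀ k : ℕ, ((Measure.pi fun _ : Fin k => m).map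
      fun x => ∑ j, Measure.dirac (x j)) Set.univ = 1 := fun k => by
    rw [Measure.map_apply (measurable_sum_dirac k) .univ]; simp
  simp [this]

lemma ae_poissonLaw [CountablyGenerated 𝓧] [MeasurableSingletonClass 𝓧] {Λ : ℝ} (hΛ : 0 < Λ)
    (m : Measure 𝓧) [IsProbabilityMeasure m] (hm : ∀ x, m {x} = 0) {S : Set 𝓧} (hS : S.Finite) :
    ∀ᵐ μ ∂(poissonLaw (ENNReal.ofReal Λ • m)), IsSimplePoint μ ∧ μ S = 0 := by
  rw [poissonLaw_eq_sum hΛ, Measure.ae_sum_iff]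
  intro k
  refine Measure.ae_smul_measure ?_ _
  rw [ae_map_iff (measurable_sum_dirac k).aemeasurable]
  · exact ae_pi_sum_dirac m hm hS k
  · exact measurableSet_isSimplePoint.inter
      ((Measure.measurable_coe hS.measurableSet) (measurableSet_singleton 0))

lemma measurable_cexp_measure {U : Set 𝓧} (hU : MeasurableSet U) (s : ℝ) :
    Measurable fun μ : Measure 𝓧 => Complex.exp (s * (μ U).toReal * Complex.I) := by
  have := (Measure.measurable_coe hU).ennreal_toReal
  fun_prop

lemma norm_cexp_mul_I (s x : ℝ) : ‖Complex.exp (s * x * Complex.I)‖ = 1 := by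
  rw [← Complex.ofReal_mul]; exact Complex.norm_exp_ofReal_mul_I _

lemma integral_cexp_poissonLaw {Λ : ℝ} (hΛ : 0 < Λ) (m : Measure 𝓧) [IsProbabilityMeasure m]
    {U : Set 𝓧} (hU : MeasurableSet U) (s : ℝ) :
    ∫ μ, Complex.exp (s * (μ U).toReal * Complex.I) ∂(poissonLaw (ENNReal.ofReal Λ • m)) =
      Complex.exp ((Complex.exp (s * Complex.I) - 1) * (Λ * m.real U)) := by
  have := isProbabilityMeasure_poissonLaw hΛ m
  have hint : Integrable (fun μ : Measure 𝓧 => Complex.exp (s * (μ U).toReal * Complex.I))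
      (poissonLaw (ENNReal.ofReal Λ • m)) :=
    .of_bound (measurable_cexp_measure hU s).aestronglyMeasurable 1
      (ae_of_all _ fun μ => (norm_cexp_mul_I _ _).le)
  rw [poissonLaw_eq_sum hΛ] at hint ⊢
  have hsum := hasSum_integral_measure hint
  -- `q` is the characteristic function of the indicator that one point falls in `U`. Given `k`
  -- points the count has characteristic function `q ^ k`, and the Poisson weights sum these to an
  -- exponential.
  set q : ℂ := 1 + (Complex.exp (s * Complex.I) - 1) * m.real U with hq
  have hone : ∫ x, (1 + U.indicator (fun _ => Complex.exp (s * Complex.I) - 1) x) ∂m = q := by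
    rw [integral_add (integrable_const _) ((integrable_const _).indicator hU),
      integral_indicator hU]
    simp [hq, mul_comm]
  have hk : ∀ k : ℕ, ∫ μ, Complex.exp (s * (μ U).toReal * Complex.I)
      ∂(ENNReal.ofReal (Real.exp (-Λ) * Λ ^ k / k.factorial) •
        (Measure.pi fun _ : Fin k => m).map fun x => ∑ j, Measure.dirac (x j)) =
      Complex.exp (-Λ) * ((Λ * q) ^ k / k.factorial) := by
    intro k
    rw [integral_smul_measure, integral_map (measurable_sum_dirac k).aemeasurable
      (measurable_cexp_measure hU s).aestronglyMeasurable]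
    have : ∀ x : Fin k → 𝓧, Complex.exp (s * ((∑ j, Measure.dirac (x j)) U).toReal * Complex.I) =
        ∏ j, (1 + U.indicator (fun _ => Complex.exp (s * Complex.I) - 1) (x j)) := by
      intro x
      rw [Measure.finsetSum_apply, ENNReal.toReal_sum (fun j _ => measure_ne_top _ _)]
      push_cast
      rw [Finset.mul_sum, Finset.sum_mul, Complex.exp_sum]
      refine Finset.prod_congr rfl fun j _ => ?_
      rw [Measure.dirac_apply' _ hU]
      by_cases hx : x j ∈ U <;> simp [hx]
    simp_rw [this]
    rw [integral_fintype_prod_eq_pow (μ := m)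
      (fun y => 1 + U.indicator (fun _ => Complex.exp (s * Complex.I) - 1) y), hone,
      ENNReal.toReal_ofReal (by positivity), Complex.real_smul]
    simp only [Fintype.card_fin]
    push_cast
    rw [mul_pow]
    ring_nf
  simp_rw [hk] at hsum
  have h2 := (NormedSpace.expSeries_div_hasSum_exp ((Λ : ℂ) * q)).mul_left (Complex.exp (-Λ))
  rw [← Complex.exp_eq_exp_ℂ, ← Complex.exp_add] at h2
  rw [hsum.unique h2, hq]
  congr 1
  ring

end Poisson

/-! ### Independent thinning of finitely many atoms. -/

section Atomic

variable {𝓧 : Type*} [MeasurableSpace 𝓧]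

/-- The Bernoulli law with success probability `a`. -/
abbrev bernoulliMeasure (a : ℝ≥0∞) : Measure ℝ≥0∞ :=
  a • Measure.dirac (1 : ℝ≥0∞) + (1 - a) • Measure.dirac (0 : ℝ≥0∞)

lemma isProbabilityMeasure_bernoulliMeasure {a : ℝ≥0∞} (ha : a ≤ 1) :
    IsProbabilityMeasure (bernoulliMeasure a) := ⟨by simp [bernoulliMeasure, add_tsub_cancel_of_le ha]⟩

lemma ae_bernoulliMeasure (a : ℝ≥0∞) : ∀ᵐ v ∂(bernoulliMeasure a), v = 0 ∨ v = 1 := by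
  rw [ae_iff]
  simp [bernoulliMeasure]

lemma measurable_atomic (ν : Measure 𝓧) (hfin : (atoms ν).Finite) :
    Measurable fun V : atoms ν → ℝ≥0∞ =>
      Measure.sum fun x : atoms ν => V x • Measure.dirac (x : 𝓧) := by
  have := hfin.to_subtype
  refine Measure.measurable_of_measurable_coe _ fun B hB => ?_
  simp only [Measure.sum_apply _ hB, Measure.smul_apply, smul_eq_mul]
  exact Measurable.tsum fun x => (measurable_pi_apply x).mul_const _

lemma isProbabilityMeasure_atomicLaw (ν : Measure 𝓧) (hfin : (atoms ν).Finite)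
    (h1 : ∀ x, ν {x} ≤ 1) : IsProbabilityMeasure (atomicLaw ν) := by
  have := fun x : atoms ν => isProbabilityMeasure_bernoulliMeasure (h1 x)
  exact Measure.isProbabilityMeasure_map (measurable_atomic ν hfin).aemeasurable

variable [MeasurableSingletonClass 𝓧]

lemma ae_atomicLaw [CountablyGenerated 𝓧] (ν : Measure 𝓧) (hfin : (atoms ν).Finite)
    (h1 : ∀ x, ν {x} ≤ 1) : ∀ᵐ μ ∂(atomicLaw ν), IsSimplePoint μ ∧ μ (atoms ν)ᶜ = 0 := by
  classical
  have := fun x : atoms ν => isProbabilityMeasure_bernoulliMeasure (h1 x)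
  have hfs := hfin.to_subtype
  unfold atomicLaw
  rw [ae_map_iff (measurable_atomic ν hfin).aemeasurable]
  swap
  · exact measurableSet_isSimplePoint.inter
      ((Measure.measurable_coe hfin.measurableSet.compl) (measurableSet_singleton 0))
  have hV : ∀ x : atoms ν, ∀ᵐ V ∂(Measure.infinitePi fun x : atoms ν => bernoulliMeasure (ν {(x : 𝓧)})),
      V x = 0 ∨ V x = 1 := fun x =>
    (measurePreserving_eval_infinitePi (fun x : atoms ν => bernoulliMeasure (ν {(x : 𝓧)}))
      x).quasiMeasurePreserving.ae (ae_bernoulliMeasure _)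
  filter_upwards [ae_all_iff.2 hV] with V hV
  have := Fintype.ofFinite (atoms ν)
  constructor
  · refine ⟨(Finset.univ.filter fun x : atoms ν => V x = 1).map (Function.Embedding.subtype _), ?_⟩
    rw [Measure.sum_fintype, Finset.sum_map, Finset.sum_filter]
    refine Finset.sum_congr rfl fun x _ => ?_
    rcases hV x with h | h <;> simp [h]
  · rw [Measure.sum_apply _ hfin.measurableSet.compl]
    simp only [Measure.smul_apply, smul_eq_mul, ENNReal.tsum_eq_zero]
    intro x
    rw [Measure.dirac_apply' _ hfin.measurableSet.compl]
    simp

end Atomic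

/-! ### The law `BeP` of a diffuse measure plus finitely many atoms. -/

section Bernoulli

variable {𝓧 : Type*} [MeasurableSpace 𝓧]

/-- The measure `∑_{x ∈ S} p x δ_x + Λ m`. -/
def mixedMeasure (m : Measure 𝓧) (S : Set 𝓧) (p : 𝓧 → ℝ) (Λ : ℝ) : Measure 𝓧 :=
  (Measure.sum fun x : S => ENNReal.ofReal (p x) • Measure.dirac (x : 𝓧)) + ENNReal.ofReal Λ • m

variable [MeasurableSingletonClass 𝓧] {m : Measure 𝓧} {S : Set 𝓧} {p : 𝓧 → ℝ} {Λ : ℝ}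

lemma mixedMeasure_singleton (hm : ∀ x, m {x} = 0) (hS : S.Finite) (x : 𝓧) :
    mixedMeasure m S p Λ {x} = S.indicator (fun x => ENNReal.ofReal (p x)) x := by
  classical
  have hfs := hS.to_subtype
  simp only [mixedMeasure, Measure.add_apply, Measure.smul_apply, hm,
    Measure.sum_apply _ (measurableSet_singleton x), smul_eq_mul, mul_zero, add_zero,
    Measure.dirac_apply' _ (measurableSet_singleton x)]
  by_cases hx : x ∈ S
  · rw [tsum_eq_single ⟨x, hx⟩]
    · simp [hx]
    · rintro ⟨y, hy⟩ hne
      have : y ≠ x := fun h => hne (Subtype.ext h)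
      simp [this]
  · rw [Set.indicator_of_notMem hx, ENNReal.tsum_eq_zero]
    rintro ⟨y, hy⟩
    have : y ≠ x := fun h => hx (h ▸ hy)
    simp [this]

lemma atoms_mixedMeasure (hm : ∀ x, m {x} = 0) (hS : S.Finite) (hp : ∀ x ∈ S, 0 < p x) :
    atoms (mixedMeasure m S p Λ) = S := by
  ext x
  simp only [atoms, Set.mem_ofPred_eq, mixedMeasure_singleton hm hS]
  by_cases hx : x ∈ S
  · simp [hx, hp x hx]
  · simp [hx]

lemma mixedMeasure_restrict_compl (hm : ∀ x, m {x} = 0) (hS : S.Finite) :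
    (mixedMeasure m S p Λ).restrict Sᶜ = ENNReal.ofReal Λ • m := by
  have hS0 : m S = 0 := by
    rw [← Set.biUnion_of_singleton S]
    exact (measure_biUnion_null_iff hS.countable).2 fun x _ => hm x
  rw [mixedMeasure, Measure.restrict_add, Measure.restrict_smul,
    Measure.restrict_sum _ hS.measurableSet.compl]
  have h1 : m.restrict Sᶜ = m := by
    rw [Measure.restrict_eq_self_of_ae_mem]
    exact measure_eq_zero_iff_ae_notMem.1 hS0
  have h2 : (Measure.sum fun x : S =>
      (ENNReal.ofReal (p x) • Measure.dirac (x : 𝓧)).restrict Sᶜ) = 0 := by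
    ext B hB
    rw [Measure.sum_apply _ hB]
    simp only [Measure.restrict_smul, Measure.smul_apply, Measure.restrict_apply hB,
      Measure.dirac_apply' _ (hB.inter hS.measurableSet.compl)]
    simp
  rw [h1, h2, zero_add]

lemma finite_atoms_mixedMeasure (hm : ∀ x, m {x} = 0) (hS : S.Finite) (hp : ∀ x ∈ S, 0 < p x) :
    (atoms (mixedMeasure m S p Λ)).Finite := by
  rwa [atoms_mixedMeasure hm hS hp]

lemma mixedMeasure_singleton_le (hm : ∀ x, m {x} = 0) (hS : S.Finite) (hp1 : ∀ x ∈ S, p x ≤ 1)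
    (x : 𝓧) : mixedMeasure m S p Λ {x} ≤ 1 := by
  rw [mixedMeasure_singleton hm hS]
  by_cases hx : x ∈ S
  · simpa [hx] using hp1 x hx
  · simp [hx]

variable [IsProbabilityMeasure m] (hm : ∀ x, m {x} = 0) (hS : S.Finite) (hp : ∀ x ∈ S, 0 < p x) (hp1 : ∀ x ∈ S, p x ≤ 1)
  (hΛ : 0 < Λ)

include hm hS hp hp1 hΛ

lemma isProbabilityMeasure_bernoulliLaw :
    IsProbabilityMeasure (bernoulliLaw (mixedMeasure m S p Λ)) := by
  unfold bernoulliLaw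
  rw [atoms_mixedMeasure hm hS hp, mixedMeasure_restrict_compl hm hS]
  have := isProbabilityMeasure_poissonLaw hΛ m
  have := isProbabilityMeasure_atomicLaw (mixedMeasure m S p Λ)
    (finite_atoms_mixedMeasure hm hS hp) (mixedMeasure_singleton_le hm hS hp1)
  exact Measure.isProbabilityMeasure_map measurable_add.aemeasurable

variable [CountablyGenerated 𝓧]

lemma ae_bernoulliLaw_prod :
    ∀ᵐ μ ∂((poissonLaw (ENNReal.ofReal Λ • m)).prod (atomicLaw (mixedMeasure m S p Λ))),
      (IsSimplePoint μ.1 ∧ μ.1 S = 0) ∧ (IsSimplePoint μ.2 ∧ μ.2 Sᶜ = 0) := by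
  have hat := atoms_mixedMeasure (Λ := Λ) hm hS hp
  have := isProbabilityMeasure_poissonLaw hΛ m
  have := isProbabilityMeasure_atomicLaw (mixedMeasure m S p Λ) (finite_atoms_mixedMeasure hm hS hp)
    (mixedMeasure_singleton_le hm hS hp1)
  have h2 := ae_atomicLaw (mixedMeasure m S p Λ) (finite_atoms_mixedMeasure hm hS hp) (mixedMeasure_singleton_le hm hS hp1)
  rw [hat] at h2
  exact (Measure.quasiMeasurePreserving_fst.ae (ae_poissonLaw hΛ m hm hS)).and
    (Measure.quasiMeasurePreserving_snd.ae h2)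

lemma ae_isSimplePoint_bernoulliLaw :
    ∀ᵐ μ ∂(bernoulliLaw (mixedMeasure m S p Λ)), IsSimplePoint μ := by
  unfold bernoulliLaw
  rw [atoms_mixedMeasure hm hS hp, mixedMeasure_restrict_compl hm hS,
    ae_map_iff measurable_add.aemeasurable measurableSet_isSimplePoint]
  filter_upwards [ae_bernoulliLaw_prod hm hS hp hp1 hΛ] with μ h
  exact h.1.1.add h.2.1 h.1.2 h.2.2

/-- Away from `S` the thinned part puts no mass, so only the Poisson part is counted. -/
lemma integral_cexp_bernoulliLaw {U : Set 𝓧} (hU : MeasurableSet U) (hUS : Disjoint S U) (s : ℝ) :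
    ∫ μ, Complex.exp (s * (μ U).toReal * Complex.I) ∂(bernoulliLaw (mixedMeasure m S p Λ)) =
      Complex.exp ((Complex.exp (s * Complex.I) - 1) * (Λ * m.real U)) := by
  have hae := ae_bernoulliLaw_prod hm hS hp hp1 hΛ
  have := isProbabilityMeasure_poissonLaw hΛ m
  have := isProbabilityMeasure_atomicLaw (mixedMeasure m S p Λ)
    (finite_atoms_mixedMeasure hm hS hp) (mixedMeasure_singleton_le hm hS hp1)
  unfold bernoulliLaw
  rw [atoms_mixedMeasure hm hS hp, mixedMeasure_restrict_compl hm hS,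
    integral_map measurable_add.aemeasurable (measurable_cexp_measure hU s).aestronglyMeasurable]
  rw [← integral_cexp_poissonLaw hΛ m hU s, ← one_smul ℝ (∫ μ, _ ∂(poissonLaw _)),
    ← probReal_univ (μ := atomicLaw (mixedMeasure m S p Λ)),
    ← integral_fun_fst (fun μ : Measure 𝓧 => Complex.exp (s * (μ U).toReal * Complex.I))]
  refine integral_congr_ae ?_
  filter_upwards [hae] with μ h
  have : μ.2 U = 0 := measure_mono_null hUS.subset_compl_left h.2.2
  simp [this]

end Bernoulli

/-! ### Gamma ratios and power sums. -/

section Analysis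

/-- Factor out `x ^ (-s)` and use `(x / y) ^ s ≥ x / y`, valid because `x / y ≤ 1` and `s ≤ 1`. -/
lemma rpow_neg_sub_rpow_neg_le {s x y : ℝ} (hs1 : s ≤ 1) (hx : 0 < x) (hxy : x ≤ y) :
    x ^ (-s) - y ^ (-s) ≤ x ^ (-s - 1) * (y - x) := by
  have hy : 0 < y := hx.trans_le hxy
  have h1 : x / y ≤ (x / y) ^ s := by
    simpa using Real.rpow_le_rpow_of_exponent_ge (div_pos hx hy) ((div_le_one hy).2 hxy) hs1
  have hxs : 0 < x ^ (-s) := Real.rpow_pos_of_pos hx _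
  have h2 : y ^ (-s) = x ^ (-s) * (x / y) ^ s := by
    rw [Real.div_rpow hx.le hy.le, Real.rpow_neg hx.le, Real.rpow_neg hy.le]
    have := (Real.rpow_pos_of_pos hx s).ne'
    field_simp
  have h3 : 1 - x / y ≤ (y - x) / x := by
    rw [one_sub_div hy.ne']
    exact div_le_div_of_nonneg_left (by linarith) hx hxy
  rw [h2, Real.rpow_sub_one hx.ne']
  calc x ^ (-s) - x ^ (-s) * (x / y) ^ s = x ^ (-s) * (1 - (x / y) ^ s) := by ring
    _ ≤ x ^ (-s) * ((y - x) / x) := by gcongr; linarith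
    _ = _ := by ring

lemma rpow_neg_anti {s x y : ℝ} (hs0 : 0 ≤ s) (hx : 0 < x) (hxy : x ≤ y) :
    y ^ (-s) ≤ x ^ (-s) :=
  Real.rpow_le_rpow_of_nonpos hx hxy (by linarith)

lemma abs_rpow_neg_sub_rpow_neg_le {s u x y : ℝ} (hs0 : 0 ≤ s) (hs1 : s ≤ 1) (hu : 0 < u)
    (hx : u ≤ x) (hy : u ≤ y) :
    |x ^ (-s) - y ^ (-s)| ≤ u ^ (-s - 1) * |x - y| := by
  wlog hxy : x ≤ y generalizing x y
  · rw [abs_sub_comm, abs_sub_comm x]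
    exact this hy hx (le_of_not_ge hxy)
  have hx0 := hu.trans_le hx
  rw [abs_of_nonneg (sub_nonneg.2 (rpow_neg_anti hs0 hx0 hxy)), abs_sub_comm,
    abs_of_nonneg (sub_nonneg.2 hxy)]
  refine (rpow_neg_sub_rpow_neg_le hs1 hx0 hxy).trans ?_
  have : x ^ (-s - 1) ≤ u ^ (-s - 1) := Real.rpow_le_rpow_of_nonpos hu hx (by linarith)
  exact mul_le_mul_of_nonneg_right this (sub_nonneg.2 hxy)

/-- Log-convexity of Gamma at `y + s = (1 - s) y + s (y + 1)`. The case `s = 1`, where a weight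
vanishes, is the functional equation. -/
lemma rpow_neg_le_Gamma_div {s y : ℝ} (hs0 : 0 < s) (hs1 : s ≤ 1) (hy : 0 < y) :
    y ^ (-s) ≤ Real.Gamma y / Real.Gamma (y + s) := by
  rw [Real.rpow_neg hy.le, le_div_iff₀ (Real.Gamma_pos_of_pos (by linarith)),
    inv_mul_le_iff₀ (Real.rpow_pos_of_pos hy s)]
  have hG := Real.Gamma_pos_of_pos hy
  rcases hs1.lt_or_eq with hs | rfl
  · have h := Real.Gamma_mul_add_mul_le_rpow_Gamma_mul_rpow_Gamma hy (t := y + 1) (by linarith)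
      (a := 1 - s) (b := s) (by linarith) hs0 (by ring)
    rw [Real.Gamma_add_one hy.ne', Real.mul_rpow hy.le hG.le] at h
    calc Real.Gamma (y + s) = Real.Gamma ((1 - s) * y + s * (y + 1)) := by ring_nf
      _ ≤ _ := h
      _ = y ^ s * (Real.Gamma y ^ (1 - s) * Real.Gamma y ^ s) := by ring
      _ = _ := by rw [← Real.rpow_add hG]; simp
  · simp [Real.Gamma_add_one hy.ne']

/-- The opposite bound comes from log-convexity at `y + 1 = s (y + s) + (1 - s) (y + s + 1)`;
replacing `y + s` by `y` in the resulting power costs a factor `1 + 1 / y`. -/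
lemma Gamma_div_le_rpow_neg {s y : ℝ} (hs0 : 0 < s) (hs1 : s ≤ 1) (hy : 0 < y) :
    Real.Gamma y / Real.Gamma (y + s) ≤ y ^ (-s) + y ^ (-s - 1) := by
  have hG := Real.Gamma_pos_of_pos hy
  have hys : 0 < y + s := by linarith
  have hGs := Real.Gamma_pos_of_pos hys
  have h1 : y * Real.Gamma y ≤ Real.Gamma (y + s) * (y + s) ^ (1 - s) := by
    rw [← Real.Gamma_add_one hy.ne']
    rcases hs1.lt_or_eq with hs | rfl
    · have h := Real.Gamma_mul_add_mul_le_rpow_Gamma_mul_rpow_Gamma hys (t := y + s + 1)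
        (by linarith) (a := s) (b := 1 - s) hs0 (by linarith) (by ring)
      rw [Real.Gamma_add_one hys.ne', Real.mul_rpow hys.le hGs.le] at h
      calc Real.Gamma (y + 1) = Real.Gamma (s * (y + s) + (1 - s) * (y + s + 1)) := by ring_nf
        _ ≤ _ := h
        _ = (Real.Gamma (y + s) ^ s * Real.Gamma (y + s) ^ (1 - s)) * (y + s) ^ (1 - s) := by ring
        _ = _ := by rw [← Real.rpow_add hGs]; simp
    · simp
  have h2 : (y + s) ^ (1 - s) ≤ y ^ (1 - s) * (1 + 1 / y) := by
    have h3 : (y + s) ^ (1 - s) = y ^ (1 - s) * (1 + s / y) ^ (1 - s) := by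
      rw [← Real.mul_rpow hy.le (by positivity)]
      congr 1
      field_simp
    rw [h3]
    gcongr
    calc (1 + s / y) ^ (1 - s) ≤ (1 + s / y) ^ (1 : ℝ) :=
          Real.rpow_le_rpow_of_exponent_le (by have : 0 ≤ s / y := by positivity
                                               linarith) (by linarith)
      _ = 1 + s / y := Real.rpow_one _
      _ ≤ _ := by gcongr
  have h4 : y ^ (1 - s) = y * y ^ (-s) := by
    rw [show 1 - s = -s + 1 by ring, Real.rpow_add_one hy.ne', mul_comm]
  rw [div_le_iff₀ hGs, Real.rpow_sub_one hy.ne']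
  refine le_of_mul_le_mul_left ?_ hy
  calc y * Real.Gamma y ≤ Real.Gamma (y + s) * (y + s) ^ (1 - s) := h1
    _ ≤ Real.Gamma (y + s) * (y ^ (1 - s) * (1 + 1 / y)) := by gcongr
    _ = _ := by rw [h4]; field_simp

/-- In the constant `1 + b`, the `1` is the error of the Gamma ratio at `b + x` and `b` is the cost
of moving the power from `b + x` to `x`. -/
lemma abs_Gamma_div_sub_rpow_neg_le {b s x : ℝ} (hb : 0 < b) (hs0 : 0 < s) (hs1 : s ≤ 1)
    (hx : 0 < x) :
    |Real.Gamma (b + x) / Real.Gamma (b + s + x) - x ^ (-s)| ≤ (1 + b) * x ^ (-s - 1) := by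
  have hy : 0 < b + x := by positivity
  have h1 := rpow_neg_le_Gamma_div hs0 hs1 hy
  have h2 := Gamma_div_le_rpow_neg hs0 hs1 hy
  have h3 := rpow_neg_sub_rpow_neg_le hs1 hx (y := b + x) (by linarith)
  have h4 := rpow_neg_anti hs0.le hx (y := b + x) (by linarith)
  have h5 : (b + x) ^ (-s - 1) ≤ x ^ (-s - 1) :=
    Real.rpow_le_rpow_of_nonpos hx (by linarith) (by linarith)
  have h6 : 0 < x ^ (-s - 1) := Real.rpow_pos_of_pos hx _
  have h7 : 0 ≤ b * x ^ (-s - 1) := by positivity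
  rw [show b + s + x = b + x + s by ring, abs_le]
  constructor <;> nlinarith

/-- The primitive of `x ^ (β - 1)` on the positive half-line. -/
def powPrimitive (β x : ℝ) : ℝ := if β = 0 then Real.log x else x ^ β / β

lemma hasDerivAt_powPrimitive (β : ℝ) {x : ℝ} (hx : 0 < x) :
    HasDerivAt (powPrimitive β) (x ^ (β - 1)) x := by
  unfold powPrimitive
  split_ifs with h
  · simpa [h, Real.rpow_neg_one] using Real.hasDerivAt_log hx.ne'
  · have := (Real.hasDerivAt_rpow_const (p := β) (Or.inl hx.ne')).div_const β
    rwa [mul_div_cancel_left₀ _ h] at this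

lemma powPrimitive_succ_sub {β : ℝ} (hβ1 : β ≤ 1) {j : ℕ} (hj : 1 ≤ j) :
    ((j + 1 : ℕ) : ℝ) ^ (β - 1) ≤ powPrimitive β (j + 1 : ℕ) - powPrimitive β j ∧
      powPrimitive β (j + 1 : ℕ) - powPrimitive β j ≤ (j : ℝ) ^ (β - 1) := by
  have hj0 : (0 : ℝ) < j := by exact_mod_cast hj
  obtain ⟨x, hx, h⟩ := exists_hasDerivAt_eq_slope (powPrimitive β) (fun x => x ^ (β - 1))
    (a := (j : ℝ)) (b := (j + 1 : ℕ)) (by push_cast; linarith)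
    (fun y hy => (hasDerivAt_powPrimitive β
      (hj0.trans_le hy.1)).continuousAt.continuousWithinAt)
    (fun y hy => hasDerivAt_powPrimitive β (hj0.trans hy.1))
  have h1 : ((j + 1 : ℕ) : ℝ) - j = 1 := by push_cast; ring
  rw [h1, div_one] at h
  rw [← h]
  have hx0 : 0 < x := hj0.trans hx.1
  exact ⟨Real.rpow_le_rpow_of_nonpos hx0 hx.2.le (by linarith),
    Real.rpow_le_rpow_of_nonpos hj0 hx.1.le (by linarith)⟩

lemma abs_sum_rpow_sub_powPrimitive_le {β : ℝ} (hβ1 : β ≤ 1) {n : ℕ} (hn : 1 ≤ n) :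
    |∑ j ∈ Finset.Ico 1 n, (j : ℝ) ^ (β - 1) - (powPrimitive β n - powPrimitive β 1)| ≤ 1 := by
  -- The bound `1 - n ^ (β - 1)` is chosen to telescope: each step adds between `0` and `j ^ (β - 1)
  -- - (j + 1) ^ (β - 1)`.
  have key : ∀ n : ℕ, 1 ≤ n →
      0 ≤ ∑ j ∈ Finset.Ico 1 n, (j : ℝ) ^ (β - 1) - (powPrimitive β n - powPrimitive β 1) ∧
      ∑ j ∈ Finset.Ico 1 n, (j : ℝ) ^ (β - 1) - (powPrimitive β n - powPrimitive β 1) ≤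
        1 - (n : ℝ) ^ (β - 1) := by
    intro n hn
    induction n, hn using Nat.le_induction with
    | base => simp
    | succ k hk ih =>
      rw [Finset.sum_Ico_succ_top hk]
      have h := powPrimitive_succ_sub hβ1 hk
      constructor <;> linarith [ih.1, ih.2, h.1, h.2]
  have h := key n hn
  have h2 : 0 ≤ (n : ℝ) ^ (β - 1) := by positivity
  rw [abs_le]
  constructor <;> linarith [h.1, h.2]

/-- The factor `b` with `∑_{j < n} j ^ (β - 1) ∼ b a_n(β)`. -/
def growthFactor (β : ℝ) : ℝ := if β = 0 then 1 else β⁻¹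

lemma growthFactor_nonneg {β : ℝ} (hβ : 0 ≤ β) : 0 ≤ growthFactor β := by
  unfold growthFactor; split_ifs <;> positivity

lemma powPrimitive_natCast (β : ℝ) (n : ℕ) : powPrimitive β n = growthFactor β * growth β n := by
  unfold powPrimitive growthFactor growth
  split_ifs <;> simp [div_eq_inv_mul]

lemma abs_sum_rpow_sub_growth_le {β : ℝ} (hβ0 : 0 ≤ β) (hβ1 : β ≤ 1) {n : ℕ} (hn : 1 ≤ n) :
    |∑ j ∈ Finset.Ico 1 n, (j : ℝ) ^ (β - 1) - growthFactor β * growth β n| ≤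
      1 + growthFactor β := by
  have h := abs_sum_rpow_sub_powPrimitive_le hβ1 hn
  have h1 : |powPrimitive β 1| ≤ growthFactor β := by
    unfold powPrimitive growthFactor
    split_ifs with h
    · simp
    · simp [abs_of_nonneg hβ0]
  rw [powPrimitive_natCast] at h
  rw [abs_le] at h h1 ⊢
  constructor <;> linarith [h.1, h.2, h1.1, h1.2]

lemma growth_nonneg {β : ℝ} (n : ℕ) : 0 ≤ growth β n := by
  unfold growth
  split_ifs
  · exact Real.log_natCast_nonneg n
  · positivity

lemma tendsto_growth {β : ℝ} (hβ : 0 ≤ β) : Tendsto (growth β) atTop atTop := by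
  unfold growth
  split_ifs with h
  · exact Real.tendsto_log_atTop.comp tendsto_natCast_atTop_atTop
  · exact (tendsto_rpow_atTop (lt_of_le_of_ne hβ (Ne.symm h))).comp tendsto_natCast_atTop_atTop

/-- The mean number of new dishes as a function of the total weight. -/
def dishRate (α β c x : ℝ) : ℝ :=
  α * (Real.Gamma (c + 1) * Real.Gamma (c + β + x)) / (Real.Gamma (c + β) * Real.Gamma (c + 1 + x))

variable {α β c : ℝ} (hα : 0 < α) (hβ0 : 0 ≤ β) (hβ1 : β < 1) (hc : -β < c)

include hα hβ1 hc in
lemma dishRate_pos {x : ℝ} (hx : 0 ≤ x) : 0 < dishRate α β c x := by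
  have h1 := Real.Gamma_pos_of_pos (s := c + 1) (by linarith)
  have h2 := Real.Gamma_pos_of_pos (s := c + β + x) (by linarith)
  have h3 := Real.Gamma_pos_of_pos (s := c + β) (by linarith)
  have h4 := Real.Gamma_pos_of_pos (s := c + 1 + x) (by linarith)
  unfold dishRate
  positivity

/-- The constant `α Γ(c + 1) / Γ(c + β)`. -/
def rateConst (α β c : ℝ) : ℝ := α * Real.Gamma (c + 1) / Real.Gamma (c + β)

include hα hβ1 hc in
lemma rateConst_pos : 0 < rateConst α β c := by
  have h1 := Real.Gamma_pos_of_pos (s := c + 1) (by linarith)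
  have h3 := Real.Gamma_pos_of_pos (s := c + β) (by linarith)
  unfold rateConst
  positivity

include hα hβ0 hβ1 hc in
lemma abs_dishRate_sub_le {x : ℝ} (hx : 0 < x) :
    |dishRate α β c x - rateConst α β c * x ^ (β - 1)| ≤
      rateConst α β c * ((1 + (c + β)) * x ^ (β - 2)) := by
  have h := abs_Gamma_div_sub_rpow_neg_le (b := c + β) (s := 1 - β) (x := x) (by linarith)
    (by linarith) (by linarith) hx
  have hC := rateConst_pos hα hβ1 hc
  have h1 : dishRate α β c x = rateConst α β c *
      (Real.Gamma (c + β + x) / Real.Gamma (c + β + (1 - β) + x)) := by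
    rw [show c + β + (1 - β) + x = c + 1 + x by ring]
    unfold dishRate rateConst
    rw [div_mul_div_comm, mul_assoc]
  rw [h1, ← mul_sub, abs_mul, abs_of_pos hC]
  rw [show -(1 - β) - 1 = β - 2 by ring, show -(1 - β) = β - 1 by ring] at h
  gcongr

lemma limitRate_eq (hc0 : β = 0 → 0 < c) (r : ℝ) (hr : 0 < r) :
    limitRate α β c r = rateConst α β c * r ^ (β - 1) * growthFactor β := by
  unfold limitRate rateConst growthFactor
  split_ifs with h
  · have hc := hc0 h
    have := (Real.Gamma_pos_of_pos hc).ne'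
    subst h
    rw [Real.Gamma_add_one hc.ne', add_zero, zero_sub, Real.rpow_neg_one]
    field_simp
  · rw [show β - 1 = -(1 - β) by ring, Real.rpow_neg hr.le, one_div, mul_inv]
    ring

end Analysis

/-! ### Deterministic asymptotics of the cumulated new-dish rate. -/

section Compensator

variable {α β c : ℝ}

lemma dishRate_zero (hβ1 : β < 1) (hc : -β < c) : dishRate α β c 0 = α := by
  have h1 := (Real.Gamma_pos_of_pos (s := c + 1) (by linarith)).ne'
  have h3 := (Real.Gamma_pos_of_pos (s := c + β) (by linarith)).ne'
  unfold dishRate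
  rw [add_zero, add_zero]
  field_simp

/-- The term `j = 0` is split off because the comparison with `x ^ (β - 1)` needs a positive total
weight. -/
lemma sum_range_dishRate (hβ1 : β < 1) (hc : -β < c) {T : ℕ → ℝ} (hT0 : T 0 = 0)
    {n : ℕ} (hn : 1 ≤ n) :
    ∑ j ∈ Finset.range n, dishRate α β c (T j) =
      α + ∑ j ∈ Finset.Ico 1 n, dishRate α β c (T j) := by
  rw [Finset.range_eq_Ico, Finset.sum_eq_sum_Ico_succ_bot (by omega), hT0, dishRate_zero hβ1 hc]

variable (hα : 0 < α) (hβ0 : 0 ≤ β) (hβ1 : β < 1) (hc : -β < c) {u : ℝ} (hu : 0 < u)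

include hα hβ0 hβ1 hc hu

/-- `B` is uniform over the weight sequences `T`, hence gives an almost sure bound with a nonrandom
constant; this keeps the exponential martingale bounded. -/
lemma exists_sum_dishRate_le : ∃ B > 0, ∀ T : ℕ → ℝ, T 0 = 0 → (∀ j : ℕ, j * u ≤ T j) → ∀ n ≥ 1,
    ∑ j ∈ Finset.range n, dishRate α β c (T j) ≤ B * (1 + growth β n) := by
  have hC := rateConst_pos hα hβ1 hc
  have hb := growthFactor_nonneg hβ0
  set C := rateConst α β c
  set b := growthFactor β
  set D := C * (1 + (1 + (c + β)) / u) * u ^ (β - 1) with hD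
  have hcβ : 0 < c + β := by linarith
  have hD0 : 0 < D := by positivity
  refine ⟨α + D * (1 + b), by positivity, fun T hT0 hT n hn => ?_⟩
  have hterm : ∀ j ∈ Finset.Ico 1 n, dishRate α β c (T j) ≤ D * (j : ℝ) ^ (β - 1) := by
    intro j hj
    have hj1 : (1 : ℝ) ≤ j := by exact_mod_cast (Finset.mem_Ico.1 hj).1
    have hx : 0 < (j : ℝ) * u := by positivity
    have hTj : 0 < T j := hx.trans_le (hT j)
    have huT : u ≤ T j := le_trans (by nlinarith) (hT j)
    have h := (abs_le.1 (abs_dishRate_sub_le hα hβ0 hβ1 hc hTj)).2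
    have h1 : T j ^ (β - 2) ≤ T j ^ (β - 1) / u := by
      rw [show β - 2 = (β - 1) - 1 by ring, Real.rpow_sub_one hTj.ne']
      gcongr
    have h2 : T j ^ (β - 1) ≤ u ^ (β - 1) * (j : ℝ) ^ (β - 1) := by
      rw [← Real.mul_rpow hu.le (by positivity), mul_comm u]
      exact Real.rpow_le_rpow_of_nonpos hx (hT j) (by linarith)
    calc dishRate α β c (T j) ≤ C * T j ^ (β - 1) + C * ((1 + (c + β)) * T j ^ (β - 2)) := by
          linarith
      _ ≤ C * T j ^ (β - 1) + C * ((1 + (c + β)) * (T j ^ (β - 1) / u)) := by gcongr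
      _ = C * (1 + (1 + (c + β)) / u) * T j ^ (β - 1) := by ring
      _ ≤ C * (1 + (1 + (c + β)) / u) * (u ^ (β - 1) * (j : ℝ) ^ (β - 1)) := by gcongr
      _ = _ := by rw [hD]; ring
  have hs := (abs_le.1 (abs_sum_rpow_sub_growth_le hβ0 hβ1.le hn)).2
  have hg := growth_nonneg (β := β) n
  calc ∑ j ∈ Finset.range n, dishRate α β c (T j)
      = α + ∑ j ∈ Finset.Ico 1 n, dishRate α β c (T j) := sum_range_dishRate hβ1 hc hT0 hn
    _ ≤ α + D * ∑ j ∈ Finset.Ico 1 n, (j : ℝ) ^ (β - 1) := by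
        rw [Finset.mul_sum]; gcongr with j hj; exact hterm j hj
    _ ≤ α + D * (1 + b + b * growth β n) := by gcongr; linarith
    _ ≤ _ := by nlinarith [mul_nonneg hα.le hg, mul_nonneg hD0.le hg]

/-- Three errors occur: the Gamma ratio, of order `j ^ (β - 2)` and summable since `β < 1`; the
replacement of `T j / j` by `r`, where `x ^ (β - 1)` is Lipschitz on `[u, ∞)`; and the comparison of
the power sum with `growth`, which stays bounded. -/
lemma exists_abs_sum_dishRate_sub_le {r : ℝ} (hr : u ≤ r) (hc0 : β = 0 → 0 < c) :
    ∃ B > 0, ∀ T : ℕ → ℝ, T 0 = 0 → (∀ j : ℕ, j * u ≤ T j) → ∀ n ≥ 1,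
    |∑ j ∈ Finset.range n, dishRate α β c (T j) - limitRate α β c r * growth β n| ≤
      B * (1 + ∑ j ∈ Finset.Icc 1 n, (j : ℝ) ^ (β - 1) * |T j / j - r|) := by
  have hC := rateConst_pos hα hβ1 hc
  have hb := growthFactor_nonneg hβ0
  have hr0 : 0 < r := hu.trans_le hr
  rw [limitRate_eq hc0 r hr0]
  set C := rateConst α β c
  set b := growthFactor β
  have hcβ : 0 < c + β := by linarith
  have hsum : Summable fun j : ℕ => (j : ℝ) ^ (β - 2) :=
    Real.summable_nat_rpow.2 (by linarith)
  set Q := ∑' j : ℕ, (j : ℝ) ^ (β - 2) with hQ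
  have hQ0 : 0 ≤ Q := tsum_nonneg fun j => by positivity
  set E := C * ((1 + (c + β)) * u ^ (β - 2)) with hE
  have hE0 : 0 < E := by positivity
  set G := C * u ^ (β - 2) with hG
  have hG0 : 0 < G := by positivity
  refine ⟨(α + E * Q + C * r ^ (β - 1) * (1 + b)) + G, by positivity, fun T hT0 hT n hn => ?_⟩
  have hterm : ∀ j ∈ Finset.Ico 1 n, |dishRate α β c (T j) - C * r ^ (β - 1) * (j : ℝ) ^ (β - 1)| ≤
      E * (j : ℝ) ^ (β - 2) + G * ((j : ℝ) ^ (β - 1) * |T j / j - r|) := by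
    intro j hj
    have hj1 : (1 : ℝ) ≤ j := by exact_mod_cast (Finset.mem_Ico.1 hj).1
    have hj0 : (0 : ℝ) < j := by linarith
    have hx : 0 < (j : ℝ) * u := by positivity
    have hTj : 0 < T j := hx.trans_le (hT j)
    have h := abs_dishRate_sub_le hα hβ0 hβ1 hc hTj
    have h1 : T j ^ (β - 2) ≤ u ^ (β - 2) * (j : ℝ) ^ (β - 2) := by
      rw [← Real.mul_rpow hu.le hj0.le, mul_comm u]
      exact Real.rpow_le_rpow_of_nonpos hx (hT j) (by linarith)
    have h2 : T j ^ (β - 1) = (j : ℝ) ^ (β - 1) * (T j / j) ^ (β - 1) := by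
      rw [← Real.mul_rpow hj0.le (by positivity), mul_div_cancel₀ _ hj0.ne']
    have h3 := abs_rpow_neg_sub_rpow_neg_le (s := 1 - β) (by linarith) (by linarith) hu
      (x := T j / j) (y := r) (by rw [le_div_iff₀ hj0]; linarith [hT j]) hr
    rw [show -(1 - β) - 1 = β - 2 by ring, show -(1 - β) = β - 1 by ring] at h3
    calc |dishRate α β c (T j) - C * r ^ (β - 1) * (j : ℝ) ^ (β - 1)|
        = |(dishRate α β c (T j) - C * T j ^ (β - 1)) +
          C * (j : ℝ) ^ (β - 1) * ((T j / j) ^ (β - 1) - r ^ (β - 1))| := by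
            rw [h2]; congr 1; ring
      _ ≤ _ := abs_add_le _ _
      _ ≤ C * ((1 + (c + β)) * (u ^ (β - 2) * (j : ℝ) ^ (β - 2))) +
          C * (j : ℝ) ^ (β - 1) * (u ^ (β - 2) * |T j / j - r|) := by
            refine add_le_add (h.trans (by gcongr)) ?_
            rw [abs_mul, abs_of_nonneg (by positivity)]
            gcongr
      _ = _ := by rw [hE, hG]; ring
  have hs := abs_sum_rpow_sub_growth_le hβ0 hβ1.le hn
  set D := ∑ j ∈ Finset.Icc 1 n, (j : ℝ) ^ (β - 1) * |T j / j - r| with hD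
  have hD0 : 0 ≤ D := Finset.sum_nonneg fun j _ => by positivity
  have h1 : ∑ j ∈ Finset.Ico 1 n, (E * (j : ℝ) ^ (β - 2) + G * ((j : ℝ) ^ (β - 1) * |T j / j - r|))
      ≤ E * Q + G * D := by
    rw [Finset.sum_add_distrib, ← Finset.mul_sum, ← Finset.mul_sum]
    gcongr
    · exact hsum.sum_le_tsum _ fun j _ => by positivity
    · exact Finset.sum_le_sum_of_subset_of_nonneg
        (fun j hj => by simp at hj ⊢; omega) fun j _ _ => by positivity
  calc |∑ j ∈ Finset.range n, dishRate α β c (T j) - C * r ^ (β - 1) * b * growth β n|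
      = |α + (∑ j ∈ Finset.Ico 1 n, (dishRate α β c (T j) - C * r ^ (β - 1) * (j : ℝ) ^ (β - 1)) +
        C * r ^ (β - 1) * (∑ j ∈ Finset.Ico 1 n, (j : ℝ) ^ (β - 1) - b * growth β n))| := by
          rw [sum_range_dishRate hβ1 hc hT0 hn, Finset.sum_sub_distrib, ← Finset.mul_sum]
          congr 1; ring
    _ ≤ |α| + (|∑ j ∈ Finset.Ico 1 n, (dishRate α β c (T j) - C * r ^ (β - 1) * (j : ℝ) ^ (β - 1))| +
        |C * r ^ (β - 1) * (∑ j ∈ Finset.Ico 1 n, (j : ℝ) ^ (β - 1) - b * growth β n)|) := by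
          refine (abs_add_le _ _).trans ?_
          gcongr
          exact abs_add_le _ _
    _ ≤ α + ((E * Q + G * D) + C * r ^ (β - 1) * (1 + b)) := by
          rw [abs_of_pos hα]
          gcongr
          · exact ((Finset.abs_sum_le_sum_abs _ _).trans (Finset.sum_le_sum hterm)).trans h1
          · rw [abs_mul, abs_of_nonneg (by positivity)]
            gcongr
    _ ≤ _ := by
          have : 0 ≤ (α + E * Q + C * r ^ (β - 1) * (1 + b)) * D := by positivity
          nlinarith

end Compensator

/-! ### Measurability with respect to the past. -/

section History

variable {Ω 𝓧 : Type*} [MeasurableSpace 𝓧] {M : ℕ → Ω → Measure 𝓧} {R : ℕ → Ω → ℝ}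

lemma history_mono : Monotone (history M R) := fun _ _ h =>
  biSup_mono fun _ hi => Finset.mem_range.2 ((Finset.mem_range.1 hi).trans_le h)

lemma measurable_measure_history {i n : ℕ} (h : i < n) : Measurable[history M R n] (M i) := by
  have h1 : MeasurableSpace.comap (M i) inferInstance ⊔
      MeasurableSpace.comap (R i) inferInstance ≤ history M R n :=
    le_biSup (fun i => MeasurableSpace.comap (M i) inferInstance ⊔
      MeasurableSpace.comap (R i) inferInstance) (Finset.mem_range.2 h)
  exact measurable_iff_comap_le.2 (le_sup_left.trans h1)

lemma measurable_weight_history {i n : ℕ} (h : i < n) : Measurable[history M R n] (R i) := by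
  have h1 : MeasurableSpace.comap (M i) inferInstance ⊔
      MeasurableSpace.comap (R i) inferInstance ≤ history M R n :=
    le_biSup (fun i => MeasurableSpace.comap (M i) inferInstance ⊔
      MeasurableSpace.comap (R i) inferInstance) (Finset.mem_range.2 h)
  exact measurable_iff_comap_le.2 (le_sup_right.trans h1)

lemma measurable_totalWeight_history (n : ℕ) : Measurable[history M R n] (totalWeight R n) :=
  Finset.measurable_fun_sum _ fun _i hi => measurable_weight_history (Finset.mem_range.1 hi)

lemma measurable_dishRate (α β c : ℝ) (hβ1 : β < 1) (hc : -β < c) :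
    Measurable fun x : Set.Ici (0 : ℝ) => dishRate α β c x := by
  have hG : ∀ b : ℝ, 0 < b → Continuous fun x : Set.Ici (0 : ℝ) => Real.Gamma (b + x) := by
    intro b hb
    rw [continuous_iff_continuousAt]
    intro x
    have hx : 0 < b + (x : ℝ) := add_pos_of_pos_of_nonneg hb x.2
    exact ContinuousAt.comp (f := fun x : Set.Ici (0 : ℝ) => b + (x : ℝ))
      (Real.differentiableAt_Gamma fun m => by
        have : (0 : ℝ) ≤ m := m.cast_nonneg
        linarith).continuousAt (by fun_prop)
  unfold dishRate
  exact (((hG (c + β) (by linarith)).measurable.const_mul _).const_mul _).div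
    ((hG (c + 1) (by linarith)).measurable.const_mul _)

/-- `dishRate` extended to be constant on the negative half-line. -/
def dishRateMax (α β c x : ℝ) : ℝ := dishRate α β c (max x 0)

lemma measurable_dishRateMax (α β c : ℝ) (hβ1 : β < 1) (hc : -β < c) :
    Measurable (dishRateMax α β c) :=
  (measurable_dishRate α β c hβ1 hc).comp
    (g := fun x : Set.Ici (0 : ℝ) => dishRate α β c x)
    (f := fun x : ℝ => ⟨max x 0, le_max_right x 0⟩)
    (Measurable.subtype_mk (measurable_id.max measurable_const))

lemma dishRateMax_of_nonneg (α β c : ℝ) {x : ℝ} (hx : 0 ≤ x) :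
    dishRateMax α β c x = dishRate α β c x := by rw [dishRateMax, max_eq_left hx]

end History

/-! ### Counting the points of a simple point measure. -/

section Simple

variable {𝓧 : Type*} [MeasurableSpace 𝓧] [MeasurableSingletonClass 𝓧]

lemma IsSimplePoint.singleton {μ : Measure 𝓧} (h : IsSimplePoint μ) (x : 𝓧) :
    μ {x} = 0 ∨ μ {x} = 1 := by
  classical
  obtain ⟨F, rfl⟩ := h
  rw [sum_dirac_singleton]
  split_ifs <;> simp

lemma IsSimplePoint.exists_finset {μ : Measure 𝓧} (h : IsSimplePoint μ) :
    ∃ F : Finset 𝓧, μ = ∑ x ∈ F, Measure.dirac x ∧ (F : Set 𝓧) = {x | μ {x} = 1} := by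
  classical
  obtain ⟨F, rfl⟩ := h
  refine ⟨F, rfl, ?_⟩
  ext x
  rw [Set.mem_ofPred_eq, sum_dirac_singleton]
  split_ifs with hx <;> simp [hx]

lemma IsSimplePoint.finite {μ : Measure 𝓧} (h : IsSimplePoint μ) : {x | μ {x} = 1}.Finite := by
  obtain ⟨F, -, hF⟩ := h.exists_finset
  exact hF ▸ F.finite_toSet

lemma IsSimplePoint.apply_eq_ncard {μ : Measure 𝓧} (h : IsSimplePoint μ) {B : Set 𝓧}
    (hB : MeasurableSet B) : μ B = ({x | μ {x} = 1} ∩ B).ncard := by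
  obtain ⟨F, h1, hF⟩ := h.exists_finset
  rw [← hF]
  conv_lhs => rw [h1]
  exact sum_dirac_apply F hB

end Simple

/-! ### The old dishes and their hazard masses. -/

section Dishes

variable {Ω 𝓧 : Type*} [MeasurableSpace 𝓧]
  {M : ℕ → Ω → Measure 𝓧} {R : ℕ → Ω → ℝ}

lemma dishes_succ (n : ℕ) (ω : Ω) :
    dishes M (n + 1) ω = dishes M n ω ∪ {x | M n ω {x} = 1} := by
  ext x
  simp only [dishes, Set.mem_ofPred_eq, Set.mem_union, Nat.lt_succ_iff_lt_or_eq]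
  constructor
  · rintro ⟨i, hi | rfl, h⟩
    · exact Or.inl ⟨i, hi, h⟩
    · exact Or.inr h
  · rintro (⟨i, hi, h⟩ | h)
    · exact ⟨i, Or.inl hi, h⟩
    · exact ⟨n, Or.inr rfl, h⟩

variable [MeasurableSingletonClass 𝓧]

lemma finite_dishes {n : ℕ} {ω : Ω} (h : ∀ i < n, IsSimplePoint (M i ω)) :
    (dishes M n ω).Finite := by
  induction n with
  | zero => simp [dishes]
  | succ n ih =>
    rw [dishes_succ]
    exact (ih fun i hi => h i (by omega)).union (h n (by omega)).finite

lemma numDishes_succ {n : ℕ} {ω : Ω} (h : ∀ i < n + 1, IsSimplePoint (M i ω)) :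
    (numDishes M (n + 1) ω : ℝ) = numDishes M n ω + (M n ω (dishes M n ω)ᶜ).toReal := by
  have hfin := finite_dishes (M := M) (n := n) (ω := ω) fun i hi => h i (by omega)
  have hn := h n (by omega)
  rw [hn.apply_eq_ncard hfin.measurableSet.compl, ENNReal.toReal_natCast, numDishes, numDishes,
    dishes_succ, ← Set.sdiff_eq, ← Set.union_sdiff_self,
    Set.ncard_union_eq Set.disjoint_sdiff_right hfin (hn.finite.sdiff)]
  push_cast
  rfl

/-- An old dish was tried by at least one customer, so its weight is at least `u > β`; it is also at
most the total weight, and `-β < c` makes the quotient at most one. -/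
lemma inclusionProb_mem {β c u : ℝ} (hβ0 : 0 ≤ β) (hc : -β < c) {n : ℕ} {ω : Ω}
    (h : ∀ i < n, IsSimplePoint (M i ω)) (hβu : β < u) (hR : ∀ i, u ≤ R i ω) {x : 𝓧}
    (hx : x ∈ dishes M n ω) :
    0 < inclusionProb β c M R n ω x ∧ inclusionProb β c M R n ω x ≤ 1 := by
  obtain ⟨i, hi, hxi⟩ := hx
  have hR0 : ∀ i, 0 ≤ R i ω := fun i => by linarith [hR i]
  have hreal : ∀ i < n, (M i ω).real {x} ≤ 1 := fun i hi => by
    rcases (h i hi).singleton x with h | h <;> simp [measureReal_def, h]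
  have h1 : u ≤ ∑ i ∈ Finset.range n, R i ω * (M i ω).real {x} := by
    calc u ≤ R i ω * (M i ω).real {x} := by simpa [measureReal_def, hxi] using hR i
      _ ≤ _ := Finset.single_le_sum (f := fun i => R i ω * (M i ω).real {x})
        (fun j _ => mul_nonneg (hR0 j) measureReal_nonneg) (Finset.mem_range.2 hi)
  have h2 : ∑ i ∈ Finset.range n, R i ω * (M i ω).real {x} ≤ totalWeight R n ω :=
    Finset.sum_le_sum fun i hi => mul_le_of_le_one_right (hR0 i) (hreal i (Finset.mem_range.1 hi))
  have h3 : 0 < totalWeight R n ω + c := by linarith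
  unfold inclusionProb
  exact ⟨div_pos (by linarith) h3, (div_le_one h3).2 (by linarith)⟩

end Dishes

/-! ### Approximating the set of new dishes by finitely valued random sets. -/

section Fresh

variable {Ω 𝓧 : Type*} [MeasurableSpace 𝓧] [CountablyGenerated 𝓧]

/-- The cells of the `j`-th partition which contain none of the first `k` customers' dishes. -/
def freshCells (M : ℕ → Ω → Measure 𝓧) (k j : ℕ) (ω : Ω) : Set (Set 𝓧) :=
  {B ∈ countablePartition 𝓧 j | ∀ i < k, M i ω B = 0}

/-- The union of the `freshCells`. -/
def freshSet (M : ℕ → Ω → Measure 𝓧) (k j : ℕ) (ω : Ω) : Set 𝓧 := ⋃₀ freshCells M k j ω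

variable {M : ℕ → Ω → Measure 𝓧} {R : ℕ → Ω → ℝ}

lemma mem_freshSet_iff {k j : ℕ} {ω : Ω} {x : 𝓧} :
    x ∈ freshSet M k j ω ↔ ∀ i < k, M i ω (countablePartitionSet j x) = 0 := by
  constructor
  · rintro ⟨B, ⟨hB, h⟩, hx⟩
    rwa [countablePartitionSet_of_mem hB hx]
  · exact fun h => ⟨_, ⟨countablePartitionSet_mem j x, h⟩, mem_countablePartitionSet j x⟩

lemma freshSet_mono (k : ℕ) (ω : Ω) : Monotone fun j => freshSet M k j ω := by
  intro j j' hj x hx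
  rw [mem_freshSet_iff] at hx ⊢
  exact fun i hi => measure_mono_null (countablePartitionSet_antitone x hj) (hx i hi)

lemma disjoint_dishes_freshSet (k j : ℕ) (ω : Ω) :
    Disjoint (dishes M k ω) (freshSet M k j ω) := by
  rw [Set.disjoint_left]
  rintro x ⟨i, hi, hx⟩ hxf
  rw [mem_freshSet_iff] at hxf
  have := measure_mono_null (Set.singleton_subset_iff.2 (mem_countablePartitionSet j x)) (hxf i hi)
  simp [this] at hx

/-- A point that is not an old dish is eventually separated from the finitely many old dishes, and
its cell is then fresh. -/
lemma iUnion_freshSet [MeasurableSingletonClass 𝓧] {k : ℕ} {ω : Ω}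
    (h : ∀ i < k, IsSimplePoint (M i ω)) : ⋃ j, freshSet M k j ω = (dishes M k ω)ᶜ := by
  refine Set.Subset.antisymm (Set.iUnion_subset fun j =>
    (disjoint_dishes_freshSet k j ω).subset_compl_left) fun x hx => ?_
  obtain ⟨j, hj⟩ := exists_forall_countablePartitionSet_inter_eq (finite_dishes h) x
  refine Set.mem_iUnion.2 ⟨j, mem_freshSet_iff.2 fun i hi => ?_⟩
  rw [(h i hi).apply_eq_ncard (measurableSet_countablePartitionSet j x)]
  have : {y | M i ω {y} = 1} ∩ countablePartitionSet j x = ∅ := by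
    refine Set.eq_empty_of_forall_notMem fun y hy => hx ?_
    have hyd : y ∈ dishes M k ω := ⟨i, hi, hy.1⟩
    have : y = x := hj j le_rfl ⟨hy.2, hyd⟩
    exact this ▸ hyd
  simp [this]

lemma measurableSet_freshCells_eq (k j : ℕ) {𝒮 : Set (Set 𝓧)} (h𝒮 : 𝒮 ⊆ countablePartition 𝓧 j) :
    MeasurableSet[history M R k] {ω | freshCells M k j ω = 𝒮} := by
  have : {ω | freshCells M k j ω = 𝒮} =
      ⋂ B ∈ countablePartition 𝓧 j, {ω | (∀ i < k, M i ω B = 0) ↔ B ∈ 𝒮} := by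
    ext ω
    simp only [freshCells, Set.mem_ofPred_eq, Set.mem_iInter, Set.ext_iff]
    refine forall_congr' fun B => ⟨fun h hB => by simpa [hB] using h, fun h => ?_⟩
    by_cases hB : B ∈ countablePartition 𝓧 j
    · simpa [hB] using h hB
    · simp only [hB, false_and, false_iff]
      exact fun h' => hB (h𝒮 h')
  rw [this]
  refine MeasurableSet.biInter (finite_countablePartition 𝓧 j).countable fun B hB => ?_
  have h0 : MeasurableSet[history M R k] {ω | ∀ i < k, M i ω B = 0} := by
    simp only [Set.ofPred_forall]
    refine MeasurableSet.iInter fun i => MeasurableSet.iInter fun hi => ?_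
    exact ((Measure.measurable_coe (measurableSet_countablePartition j hB)).comp
      (measurable_measure_history hi)) (measurableSet_singleton 0)
  by_cases h : B ∈ 𝒮
  · simpa [h] using h0
  · have h1 : {ω | (∀ i < k, M i ω B = 0) ↔ B ∈ 𝒮} = {ω | ∀ i < k, M i ω B = 0}ᶜ := by
      ext ω; simp [h]
    exact h1 ▸ h0.compl

lemma measurable_apply_freshSet {k j n : ℕ} (hkn : k ≤ n) {N : Ω → Measure 𝓧}
    (hN : Measurable[history M R n] N) :
    Measurable[history M R n] fun ω => N ω (freshSet M k j ω) := by
  classical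
  have hfs := (finite_countablePartition 𝓧 j).finite_subsets
  -- The partition is finite, so the random set has finitely many values; on each event where it is
  -- constant, `N` is evaluated at a fixed set.
  have : (fun ω => N ω (freshSet M k j ω)) = fun ω => ∑ 𝒮 ∈ hfs.toFinset,
      {ω | freshCells M k j ω = 𝒮}.indicator (fun ω => N ω (⋃₀ 𝒮)) ω := by
    ext ω
    rw [Finset.sum_eq_single (freshCells M k j ω)]
    · simp [freshSet]
    · intro 𝒮 _ h
      simp [Ne.symm h]
    · intro h
      exact absurd (hfs.mem_toFinset.2 (Set.sep_subset _ _)) h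
  rw [this]
  refine Finset.measurable_fun_sum _ fun 𝒮 h𝒮 => ?_
  have h𝒮' : 𝒮 ⊆ countablePartition 𝓧 j := hfs.mem_toFinset.1 h𝒮
  refine Measurable.indicator ?_ (history_mono hkn _ (measurableSet_freshCells_eq k j h𝒮'))
  exact (Measure.measurable_coe (.sUnion ((finite_countablePartition 𝓧 j).subset h𝒮').countable
    fun B hB => measurableSet_countablePartition j (h𝒮' hB))).comp hN

/-- The number of new dishes of customer `k + 1`, as a measurable function of the past. -/
def newDishes (M : ℕ → Ω → Measure 𝓧) (k : ℕ) (ω : Ω) : ℝ :=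
  (⨆ j, M k ω (freshSet M k j ω)).toReal

lemma measurable_newDishes (k : ℕ) : Measurable[history M R (k + 1)] (newDishes M k) :=
  Measurable.ennreal_toReal (Measurable.iSup fun _ =>
    measurable_apply_freshSet k.le_succ (measurable_measure_history k.lt_succ_self))

variable [MeasurableSingletonClass 𝓧]

lemma newDishes_eq {k : ℕ} {ω : Ω} (h : ∀ i < k, IsSimplePoint (M i ω)) :
    newDishes M k ω = (M k ω (dishes M k ω)ᶜ).toReal := by
  rw [newDishes, ← (freshSet_mono k ω).measure_iUnion, iUnion_freshSet h]

lemma numDishes_eq_sum {n : ℕ} {ω : Ω} (h : ∀ i < n, IsSimplePoint (M i ω)) :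
    (numDishes M n ω : ℝ) = ∑ k ∈ Finset.range n, newDishes M k ω := by
  induction n with
  | zero => simp [numDishes, dishes]
  | succ n ih =>
    rw [numDishes_succ h, Finset.sum_range_succ, ih fun i hi => h i (by omega),
      newDishes_eq fun i hi => h i (by omega)]

end Fresh

/-! ### From conditional probabilities of events to conditional characteristic functions. -/

/-- Since counts are integers, the characteristic function is a series in the probabilities of the
events `μ U = l`, to which the conditional law of `M k` applies. -/
lemma hasSum_real_smul_cexp {𝓧 : Type*} [MeasurableSpace 𝓧] [MeasurableSingletonClass 𝓧]
    {κ : Measure (Measure 𝓧)} [IsFiniteMeasure κ] (hκ : ∀ᵐ μ ∂κ, IsSimplePoint μ) {U : Set 𝓧}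
    (hU : MeasurableSet U) (s : ℝ) :
    HasSum (fun l : ℕ => κ.real {μ | μ U = l} • Complex.exp (s * l * Complex.I))
      (∫ μ, Complex.exp (s * (μ U).toReal * Complex.I) ∂κ) := by
  set A : ℕ → Set (Measure 𝓧) := fun l => {μ | μ U = l}
  have hA : ∀ l, MeasurableSet (A l) := fun l =>
    Measure.measurable_coe hU (measurableSet_singleton _)
  have hd : Pairwise (Function.onFun Disjoint A) := by
    intro l l' hl
    rw [Function.onFun, Set.disjoint_left]
    intro μ h1 h2
    exact hl (by exact_mod_cast (Eq.symm h1).trans h2)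
  have hcover : ∀ᵐ μ ∂κ, μ ∈ ⋃ l, A l := by
    filter_upwards [hκ] with μ hμ
    exact Set.mem_iUnion.2 ⟨_, hμ.apply_eq_ncard hU⟩
  have hint : Integrable (fun μ : Measure 𝓧 => Complex.exp (s * (μ U).toReal * Complex.I)) κ :=
    .of_bound (measurable_cexp_measure hU s).aestronglyMeasurable 1
      (ae_of_all _ fun μ => (norm_cexp_mul_I _ _).le)
  have hsum := hasSum_integral_iUnion hA hd hint.integrableOn
  rw [Measure.restrict_eq_self_of_ae_mem hcover] at hsum
  have hset : ∀ l, ∫ μ in A l, Complex.exp (s * (μ U).toReal * Complex.I) ∂κ =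
      κ.real (A l) • Complex.exp (s * l * Complex.I) := fun l => by
    rw [setIntegral_congr_fun (g := fun _ => Complex.exp (s * l * Complex.I)) (hA l),
      setIntegral_const]
    intro μ hμ
    have hμ : μ U = l := hμ
    simp [hμ]
  simpa only [hset] using hsum

lemma hasSum_integral_cexp_mul_smul {Ω : Type*} [MeasurableSpace Ω] {P : Measure Ω}
    {φ : ℕ → Ω → ℝ} (hφ : ∀ l, Integrable (φ l) P) (hφ0 : ∀ l ω, 0 ≤ φ l ω)
    (hsum : Summable fun l => ∫ ω, φ l ω ∂P) {Z : Ω → ℂ} (hZ : AEStronglyMeasurable Z P) {C : ℝ}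
    (hC : ∀ ω, ‖Z ω‖ ≤ C) (s : ℝ) :
    HasSum (fun l : ℕ => ∫ ω, Complex.exp (s * l * Complex.I) * (φ l ω • Z ω) ∂P)
      (∫ ω, ∑' l : ℕ, Complex.exp (s * l * Complex.I) * (φ l ω • Z ω) ∂P) := by
  have hint : ∀ l : ℕ, Integrable (fun ω => Complex.exp (s * l * Complex.I) * (φ l ω • Z ω)) P :=
    fun l => ((hφ l).smul_bdd C hZ (ae_of_all _ hC)).const_mul _
  refine hasSum_integral_of_summable_integral_norm hint
    (Summable.of_nonneg_of_le (fun l => integral_nonneg fun _ => norm_nonneg _) (fun l => ?_)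
      (hsum.mul_left C))
  rw [← integral_const_mul]
  refine integral_mono (hint l).norm ((hφ l).const_mul _) fun ω => ?_
  have h1 : ‖Complex.exp (s * l * Complex.I)‖ = 1 := by simpa using norm_cexp_mul_I s l
  simp only [norm_mul, h1, one_mul, norm_smul, Real.norm_of_nonneg (hφ0 l ω)]
  rw [mul_comm]
  exact mul_le_mul_of_nonneg_right (hC ω) (hφ0 l ω)

lemma hazard_eq_mixedMeasure {Ω 𝓧 : Type*} [MeasurableSpace 𝓧] (m : Measure 𝓧) (α β c : ℝ)
    (M : ℕ → Ω → Measure 𝓧) (R : ℕ → Ω → ℝ) (k : ℕ) (ω : Ω) :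
    hazard m α β c M R k ω = mixedMeasure m (dishes M k ω) (inclusionProb β c M R k ω)
      (newDishRate α β c R k ω) := rfl

lemma isFinite_and_mem {Ω 𝓧 : Type*} [MeasurableSpace 𝓧] [MeasurableSingletonClass 𝓧]
    {β c : ℝ} {M : ℕ → Ω → Measure 𝓧} {R : ℕ → Ω → ℝ}
    (hβ0 : 0 ≤ β) (hc : -β < c) {u : ℝ} (hβu : β < u)
    {k : ℕ} {ω : Ω} (hs : ∀ i < k, IsSimplePoint (M i ω)) (hR : ∀ i, u ≤ R i ω) :
    (dishes M k ω).Finite ∧ (∀ x ∈ dishes M k ω, 0 < inclusionProb β c M R k ω x) ∧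
      (∀ x ∈ dishes M k ω, inclusionProb β c M R k ω x ≤ 1) :=
  ⟨finite_dishes hs, fun _ hx => (inclusionProb_mem hβ0 hc hs hβu hR hx).1,
    fun _ hx => (inclusionProb_mem hβ0 hc hs hβu hR hx).2⟩

lemma newDishRate_pos {Ω : Type*} {α β c : ℝ} {R : ℕ → Ω → ℝ}
    (hα : 0 < α) (hβ1 : β < 1) (hc : -β < c)
    {k : ℕ} {ω : Ω} (hR : ∀ i, 0 ≤ R i ω) : 0 < newDishRate α β c R k ω :=
  dishRate_pos hα hβ1 hc (Finset.sum_nonneg fun i _ => hR i)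

/-! ### The conditional law of the number of new dishes. -/

namespace IsWeightedIBP

variable {Ω 𝓧 : Type*} [MeasurableSpace Ω] {P : Measure Ω} [IsProbabilityMeasure P]
  [MeasurableSpace 𝓧] {m : Measure 𝓧}
  {α β c : ℝ} {M : ℕ → Ω → Measure 𝓧} {R : ℕ → Ω → ℝ}

section Basic

variable (h : IsWeightedIBP P m α β c M R)
include h

omit [IsProbabilityMeasure P] in
lemma history_le (n : ℕ) : history M R n ≤ ‹MeasurableSpace Ω› :=
  iSup₂_le fun i _ => sup_le (h.measurable_measure i).comap_le (h.measurable_weight i).comap_le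

omit [IsProbabilityMeasure P] in
lemma integrable_bernoulliLaw (k : ℕ) {A : Set (Measure 𝓧)} (hA : MeasurableSet A) :
    Integrable (fun ω => (bernoulliLaw (hazard m α β c M R k ω)).real A) P :=
  integrable_condExp.congr (h.condLaw k A hA)

lemma integral_smul_indicator (k : ℕ) {A : Set (Measure 𝓧)} (hA : MeasurableSet A) {Z : Ω → ℂ}
    (hZ : StronglyMeasurable[history M R k] Z) {C : ℝ} (hC : ∀ ω, ‖Z ω‖ ≤ C) :
    ∫ ω, (M k ⁻¹' A).indicator (fun _ => (1 : ℝ)) ω • Z ω ∂P =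
      ∫ ω, (bernoulliLaw (hazard m α β c M R k ω)).real A • Z ω ∂P := by
  have hle := h.history_le k
  have hind : Integrable ((M k ⁻¹' A).indicator (fun _ => (1 : ℝ))) P :=
    (integrable_const _).indicator (h.measurable_measure k hA)
  have hb : Integrable (fun ω => (M k ⁻¹' A).indicator (fun _ => (1 : ℝ)) ω • Z ω) P :=
    hind.smul_bdd C (hZ.mono hle).aestronglyMeasurable (ae_of_all _ hC)
  have hpull := condExp_bilin_of_stronglyMeasurable_left (μ := P)
    (ContinuousLinearMap.lsmul ℝ ℝ (E := ℂ)).flip hZ (g := (M k ⁻¹' A).indicator (fun _ => (1 : ℝ)))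
    (by simpa using hb) hind
  rw [← integral_condExp hle]
  refine integral_congr_ae ?_
  filter_upwards [hpull, h.condLaw k A hA] with ω h1 h2
  rw [← h2]
  simpa using h1

omit [IsProbabilityMeasure P] in
lemma integral_indicator_preimage (k : ℕ) {A : Set (Measure 𝓧)} (hA : MeasurableSet A) :
    ∫ ω, (M k ⁻¹' A).indicator (fun _ => (1 : ℝ)) ω ∂P = P.real (M k ⁻¹' A) := by
  rw [integral_indicator_const _ (h.measurable_measure k hA), smul_eq_mul, mul_one]

lemma integral_bernoulliLaw_real (k : ℕ) {A : Set (Measure 𝓧)} (hA : MeasurableSet A) :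
    ∫ ω, (bernoulliLaw (hazard m α β c M R k ω)).real A ∂P = P.real (M k ⁻¹' A) := by
  rw [← integral_congr_ae (h.condLaw k A hA), integral_condExp (h.history_le k),
    h.integral_indicator_preimage k hA]

lemma summable_real_preimage (k : ℕ) {U : Set 𝓧} (hU : MeasurableSet U) :
    Summable fun l : ℕ => P.real (M k ⁻¹' {μ | μ U = l}) := by
  have hA : ∀ l : ℕ, MeasurableSet (M k ⁻¹' {μ | μ U = l}) := fun l =>
    h.measurable_measure k (Measure.measurable_coe hU (measurableSet_singleton _))
  have hd : Pairwise (Function.onFun Disjoint fun l : ℕ => M k ⁻¹' {μ | μ U = l}) := by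
    intro l l' hl
    rw [Function.onFun, Set.disjoint_left]
    intro ω h1 h2
    simp only [Set.mem_preimage, Set.mem_ofPred_eq] at h1 h2
    exact hl (by exact_mod_cast h1.symm.trans h2)
  exact ENNReal.summable_toReal (by rw [← measure_iUnion hd hA]; exact measure_ne_top _ _)

end Basic

variable [MeasurableSingletonClass 𝓧] [CountablyGenerated 𝓧] [IsProbabilityMeasure m]
  (h : IsWeightedIBP P m α β c M R) (hm : ∀ x, m {x} = 0)
  (hα : 0 < α) (hβ0 : 0 ≤ β) (hβ1 : β < 1) (hc : -β < c)
include h hm hα hβ0 hβ1 hc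

/-- The induction is genuine: simplicity of the earlier measures makes the old dishes finite in
number with masses in `(0, 1]`, and only then is `BeP` of the hazard shown to be a probability on
simple measures. -/
lemma ae_isSimplePoint : ∀ᵐ ω ∂P, ∀ k, IsSimplePoint (M k ω) := by
  obtain ⟨u, hu, hR⟩ := h.lower_bound
  have hR' := ae_all_iff.2 hR
  rw [ae_all_iff]
  intro k
  induction k using Nat.strong_induction_on with
  | _ k ih =>
  have hs : ∀ᵐ ω ∂P, ∀ i, i < k → IsSimplePoint (M i ω) :=
    ae_all_iff.2 fun i => eventually_imp_distrib_left.2 (ih i)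
  have hA : MeasurableSet {μ : Measure 𝓧 | IsSimplePoint μ} := measurableSet_isSimplePoint
  have h2 : ∀ᵐ ω ∂P, (bernoulliLaw (hazard m α β c M R k ω)).real
      {μ : Measure 𝓧 | IsSimplePoint μ} = 1 := by
    filter_upwards [hs, hR'] with ω hs hR
    obtain ⟨hf, hp, hp1⟩ := isFinite_and_mem (c := c) hβ0 hc
      ((le_max_left _ _).trans_lt hu) hs hR
    have hR0 : ∀ i, 0 ≤ R i ω := fun i => ((le_max_right β 0).trans_lt hu).le.trans (hR i)
    have hΛ := newDishRate_pos (k := k) hα hβ1 hc hR0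
    have := isProbabilityMeasure_bernoulliLaw hm hf hp hp1 hΛ
    have h3 := ae_isSimplePoint_bernoulliLaw hm hf hp hp1 hΛ
    rw [hazard_eq_mixedMeasure, measureReal_def, (mem_ae_iff_prob_eq_one hA).1 h3, ENNReal.toReal_one]
  have h3 := h.integral_bernoulliLaw_real k hA
  rw [integral_congr_ae h2, integral_const, probReal_univ, one_smul, measureReal_def] at h3
  exact (mem_ae_iff_prob_eq_one (h.measurable_measure k hA)).2
    ((ENNReal.toReal_eq_one_iff _).1 h3.symm)

/-- Conditional characteristic function of the number of points in a set without old dishes. -/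
lemma integral_cexp_mul_of_disjoint (k : ℕ) {U : Set 𝓧} (hU : MeasurableSet U) {Z : Ω → ℂ}
    (hZ : StronglyMeasurable[history M R k] Z) {C : ℝ} (hC : ∀ ω, ‖Z ω‖ ≤ C)
    (hZU : ∀ ω, Z ω ≠ 0 → Disjoint (dishes M k ω) U) (s : ℝ) :
    ∫ ω, Complex.exp (s * (M k ω U).toReal * Complex.I) * Z ω ∂P =
      ∫ ω, Complex.exp ((Complex.exp (s * Complex.I) - 1) * (newDishRate α β c R k ω * m.real U)) *
        Z ω ∂P := by
  obtain ⟨u, hu, hR⟩ := h.lower_bound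
  have hR' := ae_all_iff.2 hR
  have hsimple := h.ae_isSimplePoint hm hα hβ0 hβ1 hc
  have hZm := (hZ.mono (h.history_le k)).aestronglyMeasurable (μ := P)
  have hA : ∀ l : ℕ, MeasurableSet {μ : Measure 𝓧 | μ U = l} := fun l =>
    Measure.measurable_coe hU (measurableSet_singleton _)
  have hsum := h.summable_real_preimage k hU
  have hs1 := hasSum_integral_cexp_mul_smul (P := P)
    (φ := fun l : ℕ => (M k ⁻¹' {μ | μ U = l}).indicator (fun _ => (1 : ℝ)))
    (fun l => (integrable_const _).indicator (h.measurable_measure k (hA l)))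
    (fun l ω => Set.indicator_nonneg (fun _ _ => zero_le_one) ω)
    (by simpa only [h.integral_indicator_preimage k (hA _)] using hsum) hZm hC s
  have hs2 := hasSum_integral_cexp_mul_smul (P := P)
    (φ := fun (l : ℕ) ω => (bernoulliLaw (hazard m α β c M R k ω)).real {μ | μ U = l})
    (fun l => h.integrable_bernoulliLaw k (hA l)) (fun _ _ => measureReal_nonneg)
    (by simpa only [h.integral_bernoulliLaw_real k (hA _)] using hsum) hZm hC s
  simp_rw [integral_const_mul, h.integral_smul_indicator k (hA _) hZ hC] at hs1
  simp_rw [integral_const_mul] at hs2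
  -- Both series have the same terms, by the conditional law of each event `M k U = l`; so their
  -- sums agree.
  have heq := hs1.unique hs2
  calc _ = ∫ ω, ∑' l : ℕ, Complex.exp (s * l * Complex.I) *
        ((M k ⁻¹' {μ | μ U = l}).indicator (fun _ => (1 : ℝ)) ω • Z ω) ∂P := by
        refine integral_congr_ae ?_
        filter_upwards [hsimple] with ω hω
        have hl := (hω k).apply_eq_ncard hU
        rw [tsum_eq_single ({x | M k ω {x} = 1} ∩ U).ncard]
        · rw [Set.indicator_of_mem (by exact hl), one_smul, hl]
          simp
        · intro l hne
          rw [Set.indicator_of_notMem]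
          · simp
          · intro h'
            have h' : M k ω U = l := h'
            exact hne (by exact_mod_cast h'.symm.trans hl)
    _ = _ := heq
    _ = _ := by
        refine integral_congr_ae ?_
        filter_upwards [hsimple, hR'] with ω hω hR
        -- Only where `Z` is nonzero does `U` avoid the old dishes; elsewhere both integrands
        -- vanish.
        by_cases hZ0 : Z ω = 0
        · simp [hZ0]
        obtain ⟨hf, hp, hp1⟩ := isFinite_and_mem (c := c) hβ0 hc
          ((le_max_left _ _).trans_lt hu) (fun i (_ : i < k) => hω i) hR
        have hR0 : ∀ i, 0 ≤ R i ω := fun i => ((le_max_right β 0).trans_lt hu).le.trans (hR i)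
        have hΛ := newDishRate_pos (k := k) hα hβ1 hc hR0
        have := isProbabilityMeasure_bernoulliLaw hm hf hp hp1 hΛ
        have hκ := hasSum_real_smul_cexp (ae_isSimplePoint_bernoulliLaw hm hf hp hp1 hΛ) hU s
        rw [integral_cexp_bernoulliLaw hm hf hp hp1 hΛ hU (hZU ω hZ0) s] at hκ
        rw [← (hκ.mul_right (Z ω)).tsum_eq]
        refine tsum_congr fun l => ?_
        simp only [Complex.real_smul]
        rw [hazard_eq_mixedMeasure]
        ring

end IsWeightedIBP

lemma norm_cexp_sub_one_mul_le_one (s : ℝ) {x : ℝ} (hx : 0 ≤ x) :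
    ‖Complex.exp ((Complex.exp (s * Complex.I) - 1) * x)‖ ≤ 1 := by
  rw [Complex.norm_exp, Real.exp_le_one_iff]
  have h1 : ((Complex.exp (s * Complex.I) - 1) * x).re = (Real.cos s - 1) * x := by
    rw [Complex.re_mul_ofReal, Complex.sub_re, Complex.exp_ofReal_mul_I_re, Complex.one_re]
  rw [h1]
  exact mul_nonpos_of_nonpos_of_nonneg (by linarith [Real.cos_le_one s]) hx

namespace IsWeightedIBP

variable {Ω 𝓧 : Type*} [MeasurableSpace Ω] {P : Measure Ω} [IsProbabilityMeasure P]
  [MeasurableSpace 𝓧] [MeasurableSingletonClass 𝓧] [CountablyGenerated 𝓧]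
  {m : Measure 𝓧} [IsProbabilityMeasure m]
  {α β c : ℝ} {M : ℕ → Ω → Measure 𝓧} {R : ℕ → Ω → ℝ}
  (h : IsWeightedIBP P m α β c M R) (hm : ∀ x, m {x} = 0)
  (hα : 0 < α) (hβ0 : 0 ≤ β) (hβ1 : β < 1) (hc : -β < c)
include h

omit [IsProbabilityMeasure P] [MeasurableSingletonClass 𝓧] [CountablyGenerated 𝓧]
  [IsProbabilityMeasure m] in
lemma ae_nonneg : ∀ᵐ ω ∂P, ∀ i, 0 ≤ R i ω := by
  obtain ⟨u, hu, hR⟩ := h.lower_bound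
  filter_upwards [ae_all_iff.2 hR] with ω hω i
  exact ((le_max_right β 0).trans_lt hu).le.trans (hω i)

omit [IsProbabilityMeasure P] [MeasurableSingletonClass 𝓧] [CountablyGenerated 𝓧]
  [IsProbabilityMeasure m] in
lemma ae_newDishRate_eq : ∀ᵐ ω ∂P, ∀ k,
    newDishRate α β c R k ω = dishRateMax α β c (totalWeight R k ω) := by
  filter_upwards [h.ae_nonneg] with ω hω k
  exact (dishRateMax_of_nonneg _ _ _ (Finset.sum_nonneg fun i _ => hω i)).symm

include hm hα hβ0 hβ1 hc

/-- Conditional characteristic function of the number of points in the fresh cells. -/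
lemma integral_cexp_freshSet (k j : ℕ) {Z : Ω → ℂ}
    (hZ : StronglyMeasurable[history M R k] Z) {C : ℝ} (hC : ∀ ω, ‖Z ω‖ ≤ C) (s : ℝ) :
    ∫ ω, Complex.exp (s * (M k ω (freshSet M k j ω)).toReal * Complex.I) * Z ω ∂P =
      ∫ ω, Complex.exp ((Complex.exp (s * Complex.I) - 1) *
        (newDishRate α β c R k ω * m.real (freshSet M k j ω))) * Z ω ∂P := by
  classical
  have hfs := (finite_countablePartition 𝓧 j).finite_subsets
  set G : Set (Set 𝓧) → Set Ω := fun 𝒮 => {ω | freshCells M k j ω = 𝒮} with hG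
  have hle := h.history_le k
  have hZ𝒮 : ∀ 𝒮 ∈ hfs.toFinset, StronglyMeasurable[history M R k] ((G 𝒮).indicator Z) :=
    fun 𝒮 h𝒮 => hZ.indicator (measurableSet_freshCells_eq k j (hfs.mem_toFinset.1 h𝒮))
  have hC𝒮 : ∀ 𝒮 ω, ‖(G 𝒮).indicator Z ω‖ ≤ C := fun 𝒮 ω =>
    (norm_indicator_le_norm_self _ _).trans (hC ω)
  have hU : ∀ 𝒮 ∈ hfs.toFinset, MeasurableSet (⋃₀ 𝒮 : Set 𝓧) := fun 𝒮 h𝒮 =>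
    .sUnion ((finite_countablePartition 𝓧 j).subset (hfs.mem_toFinset.1 h𝒮)).countable
      fun B hB => measurableSet_countablePartition j (hfs.mem_toFinset.1 h𝒮 hB)
  -- Localizing `Z` to the events `G 𝒮`, which belong to the past, turns the random set into the
  -- fixed set `⋃₀ 𝒮`.
  have hexpand : ∀ (f : Set 𝓧 → Ω → ℂ) (ω : Ω), f (freshSet M k j ω) ω * Z ω =
      ∑ 𝒮 ∈ hfs.toFinset, f (⋃₀ 𝒮) ω * (G 𝒮).indicator Z ω := by
    intro f ω
    rw [Finset.sum_eq_single (freshCells M k j ω)]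
    · rw [Set.indicator_of_mem (by simp [hG])]; rfl
    · intro 𝒮 _ hne
      have hω : ω ∉ G 𝒮 := fun h' => hne (Eq.symm h')
      rw [Set.indicator_of_notMem hω, mul_zero]
    · exact fun h' => absurd (hfs.mem_toFinset.2 (Set.sep_subset _ _)) h'
  have hbdd : ∀ 𝒮 ∈ hfs.toFinset, ∀ f : Ω → ℂ, AEStronglyMeasurable f P →
      (∀ᵐ ω ∂P, ‖f ω‖ ≤ 1) → Integrable (fun ω => f ω * (G 𝒮).indicator Z ω) P :=
    fun 𝒮 h𝒮 f hf hf1 => (Integrable.of_bound ((hZ𝒮 𝒮 h𝒮).mono hle).aestronglyMeasurable C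
      (ae_of_all _ (hC𝒮 𝒮))).bdd_mul hf hf1
  simp_rw [hexpand (fun U ω => Complex.exp (s * (M k ω U).toReal * Complex.I)),
    hexpand (fun U ω => Complex.exp ((Complex.exp (s * Complex.I) - 1) *
      (newDishRate α β c R k ω * m.real U)))]
  rw [integral_finsetSum, integral_finsetSum]
  · refine Finset.sum_congr rfl fun 𝒮 h𝒮 => ?_
    refine h.integral_cexp_mul_of_disjoint hm hα hβ0 hβ1 hc k (hU 𝒮 h𝒮) (hZ𝒮 𝒮 h𝒮) (hC𝒮 𝒮) ?_ s
    intro ω hω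
    have hmem : ω ∈ G 𝒮 := Set.mem_of_indicator_ne_zero hω
    have : freshCells M k j ω = 𝒮 := hmem
    rw [← this]
    exact disjoint_dishes_freshSet k j ω
  · intro 𝒮 h𝒮
    refine hbdd 𝒮 h𝒮 (fun ω => Complex.exp ((Complex.exp (s * Complex.I) - 1) *
      (newDishRate α β c R k ω * m.real (⋃₀ 𝒮)))) ?_ ?_
    · have hmeas := (((measurable_dishRateMax α β c hβ1 hc).comp
        (measurable_totalWeight_history (M := M) (R := R) k)).mono hle le_rfl)
      refine AEStronglyMeasurable.congr (f := fun ω => Complex.exp ((Complex.exp (s * Complex.I) - 1) *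
        (dishRateMax α β c (totalWeight R k ω) * m.real (⋃₀ 𝒮)))) ?_ ?_
      · have h1 : Measurable fun ω => dishRateMax α β c (totalWeight R k ω) := hmeas
        exact Measurable.aestronglyMeasurable (by fun_prop)
      · filter_upwards [h.ae_newDishRate_eq] with ω hω
        rw [hω k]
    · filter_upwards [h.ae_nonneg] with ω hω
      rw [← Complex.ofReal_mul]
      exact norm_cexp_sub_one_mul_le_one s
        (mul_nonneg (newDishRate_pos hα hβ1 hc hω).le measureReal_nonneg)
  · intro 𝒮 h𝒮
    refine hbdd 𝒮 h𝒮 (fun ω => Complex.exp (s * (M k ω (⋃₀ 𝒮)).toReal * Complex.I)) ?_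
      (ae_of_all _ fun ω => (norm_cexp_mul_I _ _).le)
    exact ((measurable_cexp_measure (hU 𝒮 h𝒮) s).comp
      (h.measurable_measure k)).aestronglyMeasurable

/-- Given the past, the number of new dishes of customer `k + 1` is Poisson of mean
`newDishRate`. -/
lemma integral_cexp_newDishes (k : ℕ) {Z : Ω → ℂ}
    (hZ : StronglyMeasurable[history M R k] Z) {C : ℝ} (hC : ∀ ω, ‖Z ω‖ ≤ C) (s : ℝ) :
    ∫ ω, Complex.exp (s * newDishes M k ω * Complex.I) * Z ω ∂P =
      ∫ ω, Complex.exp ((Complex.exp (s * Complex.I) - 1) * newDishRate α β c R k ω) *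
        Z ω ∂P := by
  have hle := h.history_le k
  have hZm := (hZ.mono hle).aestronglyMeasurable (μ := P)
  have hsimple := h.ae_isSimplePoint hm hα hβ0 hβ1 hc
  have hrate : Measurable fun ω => dishRateMax α β c (totalWeight R k ω) :=
    ((measurable_dishRateMax α β c hβ1 hc).comp
      (measurable_totalWeight_history (M := M) (R := R) k)).mono hle le_rfl
  have h1 : Tendsto (fun j => ∫ ω, Complex.exp (s * (M k ω (freshSet M k j ω)).toReal * Complex.I) *
      Z ω ∂P) atTop (𝓝 (∫ ω, Complex.exp (s * newDishes M k ω * Complex.I) * Z ω ∂P)) := by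
    refine tendsto_integral_of_dominated_convergence (fun _ => C) (fun j => ?_)
      (integrable_const _) (fun j => ae_of_all _ fun ω => ?_) ?_
    · refine AEStronglyMeasurable.mul ?_ hZm
      have : Measurable fun ω => (M k ω (freshSet M k j ω)).toReal :=
        ((measurable_apply_freshSet (R := R) k.le_succ
          (measurable_measure_history k.lt_succ_self)).ennreal_toReal).mono
          (h.history_le (k + 1)) le_rfl
      exact Measurable.aestronglyMeasurable (by fun_prop)
    · rw [norm_mul, norm_cexp_mul_I, one_mul]; exact hC ω
    · refine ae_of_all _ fun ω => Tendsto.mul_const _ ?_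
      have hfin := h.isFiniteMeasure k ω
      have ht : Tendsto (fun j => (M k ω (freshSet M k j ω)).toReal) atTop
          (𝓝 (newDishes M k ω)) := by
        refine (ENNReal.tendsto_toReal ?_).comp (tendsto_atTop_iSup
          fun i j hij => measure_mono (freshSet_mono k ω hij))
        rw [← (freshSet_mono k ω).measure_iUnion]
        exact measure_ne_top _ _
      have hcont : Continuous fun x : ℝ => Complex.exp (s * x * Complex.I) := by fun_prop
      exact (hcont.tendsto _).comp ht
  have h2 : Tendsto (fun j => ∫ ω, Complex.exp ((Complex.exp (s * Complex.I) - 1) *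
      (newDishRate α β c R k ω * m.real (freshSet M k j ω))) * Z ω ∂P) atTop
      (𝓝 (∫ ω, Complex.exp ((Complex.exp (s * Complex.I) - 1) * newDishRate α β c R k ω) *
        Z ω ∂P)) := by
    refine tendsto_integral_of_dominated_convergence (fun _ => C) (fun j => ?_)
      (integrable_const _) (fun j => ?_) ?_
    · refine AEStronglyMeasurable.mul ?_ hZm
      have : Measurable fun ω => m.real (freshSet M k j ω) :=
        ((measurable_apply_freshSet (M := M) (R := R) (le_refl k)
          (measurable_const (a := m))).ennreal_toReal).mono hle le_rfl
      refine AEStronglyMeasurable.congr (f := fun ω =>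
        Complex.exp ((Complex.exp (s * Complex.I) - 1) *
        (dishRateMax α β c (totalWeight R k ω) * m.real (freshSet M k j ω)))) ?_ ?_
      · exact Measurable.aestronglyMeasurable (by fun_prop)
      · filter_upwards [h.ae_newDishRate_eq] with ω hω
        rw [hω k]
    · filter_upwards [h.ae_nonneg] with ω hω
      rw [norm_mul, ← Complex.ofReal_mul]
      exact mul_le_of_le_one_left (norm_nonneg _) (norm_cexp_sub_one_mul_le_one s
        (mul_nonneg (newDishRate_pos hα hβ1 hc hω).le measureReal_nonneg)) |>.trans (hC ω)
    · filter_upwards [hsimple] with ω hω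
      refine Tendsto.mul_const _ ?_
      have hS : m (dishes M k ω) = 0 := by
        rw [← Set.biUnion_of_singleton (dishes M k ω)]
        exact (measure_biUnion_null_iff (finite_dishes fun i _ => hω i).countable).2 fun x _ => hm x
      -- The fresh sets increase to the complement of finitely many points, which has full measure
      -- because `m` is diffuse; the limiting mean is thus the whole rate.
      have ht : Tendsto (fun j => m.real (freshSet M k j ω)) atTop (𝓝 1) := by
        have := (ENNReal.tendsto_toReal (measure_ne_top m _)).comp
          (tendsto_measure_iUnion_atTop (μ := m) (freshSet_mono (M := M) k ω))
        rw [iUnion_freshSet fun i _ => hω i,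
          measure_compl (finite_dishes fun i _ => hω i).measurableSet (measure_ne_top _ _), hS,
          measure_univ, tsub_zero, ENNReal.toReal_one] at this
        exact this
      have hcont : Continuous fun x : ℝ => Complex.exp ((Complex.exp (s * Complex.I) - 1) *
        (newDishRate α β c R k ω * x)) := by fun_prop
      have := (hcont.tendsto 1).comp ht
      simpa [Function.comp_def] using this
  simp_rw [h.integral_cexp_freshSet hm hα hβ0 hβ1 hc k _ hZ hC s] at h1
  exact tendsto_nhds_unique h1 h2

end IsWeightedIBP

/-! ### Complex exponential estimates and the exponential martingale. -/

section ComplexExp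

/-- The derivative of `exp` has norm at most one on the left half-plane, which is convex. -/
lemma norm_cexp_sub_cexp_le {z w : ℂ} (hz : z.re ≤ 0) (hw : w.re ≤ 0) :
    ‖Complex.exp z - Complex.exp w‖ ≤ ‖z - w‖ := by
  have hconv : Convex ℝ {z : ℂ | z.re ≤ 0} := convex_halfSpace_re_le 0
  have := hconv.norm_image_sub_le_of_norm_hasDerivWithin_le (f := Complex.exp)
    (f' := Complex.exp) (C := 1) (fun x _ => (Complex.hasDerivAt_exp x).hasDerivWithinAt)
    (fun x hx => by rw [Complex.norm_exp, Real.exp_le_one_iff]; exact hx) hw hz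
  simpa using this

lemma norm_cexp_mul_I_sub_taylor_le {s : ℝ} (hs : |s| ≤ 1) :
    ‖Complex.exp (s * Complex.I) - 1 - s * Complex.I + s ^ 2 / 2‖ ≤ |s| ^ 3 := by
  have h1 : ‖(s : ℂ) * Complex.I‖ = |s| := by simp
  have h := Complex.exp_bound (x := s * Complex.I) (h1.trans_le hs) (n := 3) (by norm_num)
  rw [h1] at h
  have h2 : Complex.exp (s * Complex.I) - 1 - s * Complex.I + s ^ 2 / 2 =
      Complex.exp (s * Complex.I) - ∑ m ∈ Finset.range 3, (s * Complex.I) ^ m / m.factorial := by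
    simp only [Finset.sum_range_succ, Finset.sum_range_zero, Nat.factorial]
    have : (s * Complex.I : ℂ) ^ 2 = -s ^ 2 := by rw [mul_pow, Complex.I_sq]; ring
    rw [this]
    push_cast
    ring
  rw [h2]
  refine h.trans (mul_le_of_le_one_right (by positivity) ?_)
  norm_num [Nat.factorial]

lemma re_cexp_mul_I_sub_one_mul (s x : ℝ) :
    ((Complex.exp (s * Complex.I) - 1) * x).re = (Real.cos s - 1) * x := by
  rw [Complex.re_mul_ofReal, Complex.sub_re, Complex.exp_ofReal_mul_I_re, Complex.one_re]

end ComplexExp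

/-- The variables `N k` are conditionally Poisson with parameters `V k`: `V k` is known at time `k`
and `N k` at time `k + 1`. -/
structure IsConditionallyPoisson {Ω : Type*} {mΩ : MeasurableSpace Ω} (P : Measure Ω)
    (ℱ : Filtration ℕ mΩ) (N V : ℕ → Ω → ℝ) : Prop where
  measurable_count : ∀ k, Measurable[ℱ (k + 1)] (N k)
  measurable_rate : ∀ k, Measurable[ℱ k] (V k)
  rate_nonneg : ∀ k ω, 0 ≤ V k ω
  integral_cexp : ∀ k (Z : Ω → ℂ) (C : ℝ), StronglyMeasurable[ℱ k] Z → (∀ ω, ‖Z ω‖ ≤ C) → ∀ s : ℝ,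
    ∫ ω, Complex.exp (s * N k ω * Complex.I) * Z ω ∂P =
      ∫ ω, Complex.exp ((Complex.exp (s * Complex.I) - 1) * V k ω) * Z ω ∂P
  rate_bdd : ∀ n, ∃ K : ℝ, ∀ᵐ ω ∂P, ∑ k ∈ Finset.range n, V k ω ≤ K

/-- The exponential martingale `exp (i s ∑ N - (e^{is} - 1) ∑ V)`. -/
def expMartingale {Ω : Type*} (N V : ℕ → Ω → ℝ) (s : ℝ) (n : ℕ) (ω : Ω) : ℂ :=
  Complex.exp (s * (∑ k ∈ Finset.range n, N k ω : ℝ) * Complex.I -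
    (Complex.exp (s * Complex.I) - 1) * (∑ k ∈ Finset.range n, V k ω : ℝ))

lemma norm_expMartingale_le {Ω : Type*} {N V : ℕ → Ω → ℝ} {s : ℝ} {n : ℕ} {ω : Ω}
    (hV : 0 ≤ ∑ k ∈ Finset.range n, V k ω) :
    ‖expMartingale N V s n ω‖ ≤ Real.exp (s ^ 2 / 2 * ∑ k ∈ Finset.range n, V k ω) := by
  rw [expMartingale, Complex.norm_exp, Complex.sub_re, re_cexp_mul_I_sub_one_mul,
    ← Complex.ofReal_mul, Complex.re_ofReal_mul]
  simp only [Complex.I_re, mul_zero, zero_sub]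
  rw [Real.exp_le_exp, ← neg_mul]
  exact mul_le_mul_of_nonneg_right (by linarith [Real.one_sub_sq_div_two_le_cos (x := s)]) hV

namespace IsConditionallyPoisson

variable {Ω : Type*} {mΩ : MeasurableSpace Ω} {P : Measure Ω} [IsProbabilityMeasure P]
  {ℱ : Filtration ℕ mΩ} {N V : ℕ → Ω → ℝ} (h : IsConditionallyPoisson P ℱ N V)
include h

omit [IsProbabilityMeasure P] in
lemma sum_rate_nonneg (n : ℕ) (ω : Ω) : 0 ≤ ∑ k ∈ Finset.range n, V k ω :=
  Finset.sum_nonneg fun k _ => h.rate_nonneg k ω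

omit [IsProbabilityMeasure P] in
lemma measurable_sum_count (n : ℕ) :
    Measurable[ℱ n] fun ω => ∑ k ∈ Finset.range n, N k ω :=
  Finset.measurable_fun_sum _ fun k hk => (h.measurable_count k).mono
    (ℱ.mono (Nat.succ_le_of_lt (Finset.mem_range.1 hk))) le_rfl

omit [IsProbabilityMeasure P] in
lemma measurable_sum_rate (n : ℕ) :
    Measurable[ℱ n] fun ω => ∑ k ∈ Finset.range (n + 1), V k ω :=
  Finset.measurable_fun_sum _ fun k hk => (h.measurable_rate k).mono
    (ℱ.mono (Nat.le_of_lt_succ (Finset.mem_range.1 hk))) le_rfl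

omit [IsProbabilityMeasure P] in
lemma measurable_sum_rate' (n : ℕ) :
    Measurable[ℱ n] fun ω => ∑ k ∈ Finset.range n, V k ω :=
  Finset.measurable_fun_sum _ fun k hk => (h.measurable_rate k).mono
    (ℱ.mono (Finset.mem_range.1 hk).le) le_rfl

omit [IsProbabilityMeasure P] in
lemma measurable_expMartingale (s : ℝ) (n : ℕ) : Measurable[ℱ n] (expMartingale N V s n) := by
  have h1 := h.measurable_sum_count n
  have h2 := h.measurable_sum_rate' n
  unfold expMartingale
  fun_prop

omit [IsProbabilityMeasure P] in
lemma integral_cexp_of_ae_bdd (k : ℕ) {Z : Ω → ℂ} {C : ℝ} (hZ : Measurable[ℱ k] Z)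
    (hC : ∀ᵐ ω ∂P, ‖Z ω‖ ≤ C) (s : ℝ) :
    ∫ ω, Complex.exp (s * N k ω * Complex.I) * Z ω ∂P =
      ∫ ω, Complex.exp ((Complex.exp (s * Complex.I) - 1) * V k ω) * Z ω ∂P := by
  have hS : MeasurableSet[ℱ k] {ω | ‖Z ω‖ ≤ C} := by
    have : Measurable[ℱ k] fun ω => ‖Z ω‖ := measurable_norm.comp hZ
    exact this measurableSet_Iic
  have hae : ∀ᵐ ω ∂P, {ω | ‖Z ω‖ ≤ C}.indicator Z ω = Z ω := by
    filter_upwards [hC] with ω hω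
    exact Set.indicator_of_mem (s := {ω | ‖Z ω‖ ≤ C}) hω Z
  have := h.integral_cexp k ({ω | ‖Z ω‖ ≤ C}.indicator Z) (max C 0)
    (hZ.indicator hS).stronglyMeasurable (fun ω => by
      by_cases hω : ω ∈ {ω | ‖Z ω‖ ≤ C}
      · rw [Set.indicator_of_mem hω]; exact le_max_of_le_left hω
      · rw [Set.indicator_of_notMem hω]; simp) s
  rw [integral_congr_ae (g := fun ω => Complex.exp (s * N k ω * Complex.I) *
      {ω | ‖Z ω‖ ≤ C}.indicator Z ω), this]
  · refine integral_congr_ae ?_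
    filter_upwards [hae] with ω hω
    rw [hω]
  · filter_upwards [hae] with ω hω
    rw [hω]

omit [IsProbabilityMeasure P] in
-- The martingale property, in the weak form of tests against the past.
lemma integral_mul_expMartingale {k n : ℕ} (hkn : k ≤ n) {Y : Ω → ℂ} (hY : Measurable[ℱ k] Y)
    (hY1 : ∀ᵐ ω ∂P, ‖Y ω‖ ≤ 1) (s : ℝ) :
    ∫ ω, Y ω * expMartingale N V s n ω ∂P = ∫ ω, Y ω * expMartingale N V s k ω ∂P := by
  induction n, hkn using Nat.le_induction with
  | base => rfl
  | succ n hkn ih =>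
    rw [← ih]
    -- The rates run one index further than the counts: `V n` is known at time `n`, `N n` is not.
    -- Multiplying by `e^{i s N n}` gives the martingale at `n + 1`, and the conditional Poisson
    -- identity then cancels `V n`.
    set Z : Ω → ℂ := fun ω => Y ω * Complex.exp (s * (∑ k ∈ Finset.range n, N k ω : ℝ) * Complex.I -
      (Complex.exp (s * Complex.I) - 1) * (∑ k ∈ Finset.range (n + 1), V k ω : ℝ)) with hZdef
    have hZ : Measurable[ℱ n] Z := by
      have h1 := h.measurable_sum_count n
      have h2 := h.measurable_sum_rate n
      have h3 : Measurable[ℱ n] Y := hY.mono (ℱ.mono hkn) le_rfl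
      fun_prop
    obtain ⟨K, hK⟩ := h.rate_bdd (n + 1)
    have hbdd : ∀ᵐ ω ∂P, ‖Z ω‖ ≤ Real.exp (2 * K) := by
      filter_upwards [hK, hY1] with ω hω hY
      rw [hZdef, norm_mul]
      refine (mul_le_of_le_one_left (norm_nonneg _) hY).trans ?_
      rw [Complex.norm_exp, Complex.sub_re, re_cexp_mul_I_sub_one_mul,
        ← Complex.ofReal_mul, Complex.re_ofReal_mul]
      simp only [Complex.I_re, mul_zero, zero_sub]
      rw [Real.exp_le_exp]
      have := h.sum_rate_nonneg (n + 1) ω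
      nlinarith [Real.neg_one_le_cos s]
    have key := h.integral_cexp_of_ae_bdd n hZ hbdd s
    calc _ = ∫ ω, Complex.exp (s * N n ω * Complex.I) * Z ω ∂P := by
          refine integral_congr_ae (ae_of_all _ fun ω => ?_)
          simp only [expMartingale, hZdef]
          rw [mul_left_comm, ← Complex.exp_add, Finset.sum_range_succ (fun k => N k ω)]
          push_cast
          ring_nf
      _ = _ := key
      _ = _ := by
          refine integral_congr_ae (ae_of_all _ fun ω => ?_)
          simp only [expMartingale, hZdef]
          rw [mul_left_comm, ← Complex.exp_add, Finset.sum_range_succ (fun k => V k ω)]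
          push_cast
          ring_nf

/-- By the martingale property time can be frozen at `k`; there only `s n` varies, and dominated
convergence applies. -/
lemma tendsto_integral_mul_expMartingale (k : ℕ) {Y : Ω → ℂ} (hY : Measurable[ℱ k] Y)
    (hY1 : ∀ᵐ ω ∂P, ‖Y ω‖ ≤ 1) {s : ℕ → ℝ} (hs : Tendsto s atTop (𝓝 0)) :
    Tendsto (fun n => ∫ ω, Y ω * expMartingale N V (s n) n ω ∂P) atTop (𝓝 (∫ ω, Y ω ∂P)) := by
  obtain ⟨K, hK⟩ := h.rate_bdd k
  have hlim : Tendsto (fun n => ∫ ω, Y ω * expMartingale N V (s n) k ω ∂P) atTop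
      (𝓝 (∫ ω, Y ω ∂P)) := by
    refine tendsto_integral_filter_of_dominated_convergence (fun _ => Real.exp (1 / 2 * K)) ?_ ?_
      (integrable_const _) ?_
    · refine Eventually.of_forall fun n => ?_
      exact ((hY.mul (h.measurable_expMartingale (s n) k)).mono (ℱ.le k) le_rfl).aestronglyMeasurable
    · have : ∀ᶠ n in atTop, (s n) ^ 2 ≤ 1 := by
        have h2 : Tendsto (fun n => (s n) ^ 2) atTop (𝓝 0) := by simpa using hs.pow 2
        exact h2.eventually_le_const one_pos
      filter_upwards [this] with n hn
      filter_upwards [hK, hY1] with ω hω hY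
      rw [norm_mul]
      refine (mul_le_of_le_one_left (norm_nonneg _) hY).trans
        ((norm_expMartingale_le (h.sum_rate_nonneg k ω)).trans ?_)
      rw [Real.exp_le_exp]
      have := h.sum_rate_nonneg k ω
      gcongr
    · refine ae_of_all _ fun ω => ?_
      have hcont : Continuous fun s : ℝ => Y ω * expMartingale N V s k ω := by
        unfold expMartingale; fun_prop
      have := (hcont.tendsto 0).comp hs
      simpa [expMartingale, Function.comp_def] using this
  refine hlim.congr' ?_
  filter_upwards [eventually_ge_atTop k] with n hn
  exact (h.integral_mul_expMartingale hn hY hY1 (s n)).symm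

variable {a : ℕ → ℝ} {l B : ℝ}

omit [IsProbabilityMeasure P] in
lemma norm_cexp_sub_expMartingale_le {t : ℝ} {n : ℕ} (hl : 0 ≤ l) (ha1 : 1 ≤ a n) (hat : t ^ 2 ≤ a n)
    {ω : Ω}
    (hω : ∑ k ∈ Finset.range n, V k ω ≤ B * (1 + a n)) :
    ‖Complex.exp (t * (√(a n) * ((∑ k ∈ Finset.range n, N k ω) / a n - l) : ℝ) * Complex.I) -
      Complex.exp (-(l * t ^ 2 / 2 : ℝ)) * expMartingale N V (t / √(a n)) n ω‖ ≤
    Real.exp (B * t ^ 2) * (2 * B * |t| ^ 3 / √(a n) +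
      (|t| + t ^ 2) * (|∑ k ∈ Finset.range n, V k ω - l * a n| / √(a n))) := by
  have ha0 : 0 < a n := by linarith
  have hsq : 0 < √(a n) := Real.sqrt_pos.2 ha0
  have hsq2 : √(a n) ^ 2 = a n := Real.sq_sqrt ha0.le
  have hsq1 : 1 ≤ √(a n) := Real.one_le_sqrt.2 ha1
  set q := √(a n) with hq
  set s := t / q with hs
  set A := ∑ k ∈ Finset.range n, V k ω with hA
  set L := ∑ k ∈ Finset.range n, N k ω with hL
  have hA0 : 0 ≤ A := h.sum_rate_nonneg n ω
  have hsa : s ^ 2 * a n = t ^ 2 := by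
    rw [hs, div_pow, hsq2]; field_simp
  have hs1 : |s| ≤ 1 := by
    rw [hs, abs_div, abs_of_pos hsq, div_le_one hsq]
    exact Real.abs_le_sqrt hat
  -- `ζ` is what remains of `i t X_n` once the exponent of the martingale is removed.
  set ζ : ℂ := (Complex.exp (s * Complex.I) - 1) * A - s * (l * a n) * Complex.I with hζ
  have hexp : Complex.exp (t * (q * (L / a n - l) : ℝ) * Complex.I) =
      expMartingale N V s n ω * Complex.exp ζ := by
    rw [expMartingale, ← Complex.exp_add, hζ]
    congr 1
    have h1 : t * (q * (L / a n - l)) = s * L - s * (l * a n) := by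
      rw [hs, ← hsq2]; field_simp
    have h2 : (t : ℂ) * ((q * (L / a n - l) : ℝ) : ℂ) = s * L - s * (l * a n) := by
      exact_mod_cast congrArg Complex.ofReal h1
    rw [h2]
    ring
  have hre : ζ.re ≤ 0 := by
    rw [hζ, Complex.sub_re, re_cexp_mul_I_sub_one_mul]
    have h1 : ((s : ℂ) * (l * a n) * Complex.I).re = 0 := by
      rw [← Complex.ofReal_mul, ← Complex.ofReal_mul, Complex.re_ofReal_mul]; simp
    rw [h1, sub_zero]
    exact mul_nonpos_of_nonpos_of_nonneg (by linarith [Real.cos_le_one s]) hA0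
  have hW : ‖expMartingale N V s n ω‖ ≤ Real.exp (B * t ^ 2) := by
    refine (norm_expMartingale_le hA0).trans (Real.exp_le_exp.2 ?_)
    have hB0 : 0 ≤ B := by
      by_contra hneg
      have : B * (1 + a n) < 0 := mul_neg_of_neg_of_pos (by linarith) (by linarith)
      linarith
    calc s ^ 2 / 2 * A ≤ s ^ 2 / 2 * (B * (1 + a n)) := by gcongr
      _ ≤ s ^ 2 / 2 * (B * (a n + a n)) := by gcongr
      _ = B * (s ^ 2 * a n) := by ring
      _ = _ := by rw [hsa]
  have hdiff : ‖Complex.exp ζ - Complex.exp (-(l * t ^ 2 / 2 : ℝ))‖ ≤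
      2 * B * |t| ^ 3 / q + (|t| + t ^ 2) * (|A - l * a n| / q) := by
    refine (norm_cexp_sub_cexp_le hre ?_).trans ?_
    · rw [← Complex.ofReal_neg, Complex.ofReal_re]
      have : 0 ≤ l * t ^ 2 / 2 := by positivity
      linarith
    -- Second-order expansion of `e^{is} - 1`, using `s² a_n = t²`: a cubic remainder times `A`,
    -- plus a term of order `s` times the deviation `A - l a_n`.
    have hid : ζ - (-(l * t ^ 2 / 2 : ℝ) : ℂ) =
        (Complex.exp (s * Complex.I) - 1 - s * Complex.I + s ^ 2 / 2) * A +
          (s * Complex.I - s ^ 2 / 2) * ((A - l * a n : ℝ) : ℂ) := by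
      have h1 : (t : ℂ) ^ 2 = s ^ 2 * a n := by exact_mod_cast hsa.symm
      rw [hζ]
      push_cast
      rw [h1]
      ring
    rw [hid]
    refine (norm_add_le _ _).trans (add_le_add ?_ ?_)
    · rw [norm_mul, Complex.norm_real, Real.norm_of_nonneg hA0]
      calc _ ≤ |s| ^ 3 * (B * (1 + a n)) := by
            gcongr; exact norm_cexp_mul_I_sub_taylor_le hs1
        _ ≤ |s| ^ 3 * (B * (a n + a n)) := by
            have hB0 : 0 ≤ B := by
              by_contra hneg
              have : B * (1 + a n) < 0 := mul_neg_of_neg_of_pos (by linarith) (by linarith)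
              linarith
            gcongr
        _ = _ := by
            rw [hs, abs_div, abs_of_pos hsq, ← hsq2]; field_simp; ring
    · rw [norm_mul, Complex.norm_real, Real.norm_eq_abs]
      have h1 : ‖(s : ℂ) * Complex.I - s ^ 2 / 2‖ ≤ (|t| + t ^ 2) / q := by
        refine (norm_sub_le _ _).trans ?_
        have e1 : ‖(s : ℂ) * Complex.I‖ = |t| / q := by
          rw [norm_mul, Complex.norm_I, mul_one, Complex.norm_real, Real.norm_eq_abs, hs, abs_div,
            abs_of_pos hsq]
        have e2 : ‖(s : ℂ) ^ 2 / 2‖ ≤ t ^ 2 / q := by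
          have : (s : ℂ) ^ 2 / 2 = ((s ^ 2 / 2 : ℝ) : ℂ) := by push_cast; rfl
          rw [this, Complex.norm_real, Real.norm_of_nonneg (by positivity), hs, div_pow, hsq2, ← hsq2]
          rw [div_div]
          gcongr
          nlinarith
        rw [e1, add_div]
        linarith
      calc _ ≤ (|t| + t ^ 2) / q * |A - l * a n| := by gcongr
        _ = _ := by ring
  calc _ = ‖expMartingale N V s n ω‖ * ‖Complex.exp ζ - Complex.exp (-(l * t ^ 2 / 2 : ℝ))‖ := by
        rw [hexp, ← norm_mul]; congr 1; ring
    _ ≤ _ := by gcongr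

end IsConditionallyPoisson

/-! ### From characteristic functions to stable convergence. -/

section Stable

variable {Ω : Type*} [mΩ : MeasurableSpace Ω] {P : Measure Ω} [IsProbabilityMeasure P]

/-- Convergence of characteristic functions under every conditioning gives stable convergence to a
Gaussian law. -/
lemma convergesStably_gaussian {X : ℕ → Ω → ℝ} (hX : ∀ n, AEMeasurable (X n) P) {v : ℝ}
    (hv : 0 ≤ v)
    (hlim : ∀ H : Set Ω, MeasurableSet H → ∀ t : ℝ,
      Tendsto (fun n => ∫ ω in H, Complex.exp (t * X n ω * Complex.I) ∂P) atTop
        (𝓝 (P.real H * Complex.exp (-(v * t ^ 2 / 2 : ℝ))))) :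
    ConvergesStably P X (Kernel.const Ω (gaussianReal 0 v.toNNReal)) := by
  refine ⟨hX, fun H hH hPH f => ?_⟩
  have := cond_isProbabilityMeasure (μ := P) (s := H) hPH.ne'
  have hXc : ∀ n, AEMeasurable (X n) (cond P H) := fun n =>
    (hX n).mono_ac cond_absolutelyContinuous
  set μ : ℕ → ProbabilityMeasure ℝ := fun n =>
    ⟨(cond P H).map (X n), Measure.isProbabilityMeasure_map (hXc n)⟩ with hμ
  set μ₀ : ProbabilityMeasure ℝ := ⟨gaussianReal 0 v.toNNReal, inferInstance⟩ with hμ₀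
  have ht : Tendsto μ atTop (𝓝 μ₀) := by
    refine ProbabilityMeasure.tendsto_of_tendsto_charFun fun t => ?_
    have h0 : charFun (μ₀ : Measure ℝ) t = Complex.exp (-(v * t ^ 2 / 2 : ℝ)) := by
      change charFun (gaussianReal 0 v.toNNReal) t = _
      rw [charFun_gaussianReal, Real.coe_toNNReal _ hv]
      push_cast
      congr 1
      ring
    have hn : ∀ n, charFun (μ n : Measure ℝ) t =
        ((P.real H)⁻¹ : ℝ) • ∫ ω in H, Complex.exp (t * X n ω * Complex.I) ∂P := by
      intro n
      change charFun ((cond P H).map (X n)) t = _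
      rw [charFun_apply_real, integral_map (hXc n) (by fun_prop), ProbabilityTheory.cond, integral_smul_measure,
        ENNReal.toReal_inv]
      rfl
    simp_rw [hn]
    rw [h0]
    have h1 := (hlim H hH t).const_smul ((P.real H)⁻¹ : ℝ)
    have h2 : P.real H ≠ 0 := (ENNReal.toReal_pos hPH.ne' (measure_ne_top _ _)).ne'
    convert h1 using 2
    rw [Complex.real_smul, ← mul_assoc, ← Complex.ofReal_mul, inv_mul_cancel₀ h2]
    simp
  have h3 := ProbabilityMeasure.tendsto_iff_forall_integral_tendsto.1 ht f
  have h4 : ∀ n, ∫ x, f x ∂(μ n : Measure ℝ) = ∫ ω, f (X n ω) ∂(cond P H) := fun n =>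
    integral_map (hXc n) f.continuous.aestronglyMeasurable
  simp_rw [h4] at h3
  simpa [hμ₀] using h3

end Stable

/-! ### The stable central limit theorem for conditionally Poisson increments. -/

namespace IsConditionallyPoisson

variable {Ω : Type*} {mΩ : MeasurableSpace Ω} {P : Measure Ω} [IsProbabilityMeasure P]
  {ℱ : Filtration ℕ mΩ} {N V : ℕ → Ω → ℝ} (h : IsConditionallyPoisson P ℱ N V)
  {a : ℕ → ℝ} {l B : ℝ} (ha : Tendsto a atTop atTop) (hl : 0 ≤ l)
  (hB : ∀ᶠ n in atTop, ∀ᵐ ω ∂P, ∑ k ∈ Finset.range n, V k ω ≤ B * (1 + a n))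
  (hdev : Tendsto (fun n => (∫ ω, |∑ k ∈ Finset.range n, V k ω - l * a n| ∂P) / √(a n)) atTop (𝓝 0))

/-- The normalized number of points. -/
def normalizedCount (N : ℕ → Ω → ℝ) (a : ℕ → ℝ) (l : ℝ) (n : ℕ) (ω : Ω) : ℝ :=
  √(a n) * ((∑ k ∈ Finset.range n, N k ω) / a n - l)

include h

omit [IsProbabilityMeasure P] in
lemma measurable_normalizedCount (n : ℕ) : Measurable[ℱ n] (normalizedCount N a l n) := by
  have := h.measurable_sum_count n
  unfold normalizedCount
  fun_prop

lemma integrable_abs_sub (n : ℕ) (b : ℝ) :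
    Integrable (fun ω => |∑ k ∈ Finset.range n, V k ω - b|) P := by
  obtain ⟨K, hK⟩ := h.rate_bdd n
  refine Integrable.abs (Integrable.sub ?_ (integrable_const b))
  refine Integrable.of_bound ((h.measurable_sum_rate' n).mono (ℱ.le n) le_rfl).aestronglyMeasurable
    K ?_
  filter_upwards [hK] with ω hω
  rwa [Real.norm_of_nonneg (h.sum_rate_nonneg n ω)]

include ha hl hB hdev

lemma tendsto_integral_mul_cexp (k : ℕ) {Y : Ω → ℂ} (hY : Measurable[ℱ k] Y)
    (hY1 : ∀ᵐ ω ∂P, ‖Y ω‖ ≤ 1) (t : ℝ) :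
    Tendsto (fun n => ∫ ω, Y ω * Complex.exp (t * normalizedCount N a l n ω * Complex.I) ∂P) atTop
      (𝓝 ((∫ ω, Y ω ∂P) * Complex.exp (-(l * t ^ 2 / 2 : ℝ)))) := by
  have hsqrt : Tendsto (fun n => √(a n)) atTop atTop := Real.tendsto_sqrt_atTop.comp ha
  have hs : Tendsto (fun n => t / √(a n)) atTop (𝓝 0) := hsqrt.const_div_atTop t
  set E : ℂ := Complex.exp (-(l * t ^ 2 / 2 : ℝ)) with hE
  have hmain := (h.tendsto_integral_mul_expMartingale k hY hY1 hs).mul_const E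
  have hYm : AEStronglyMeasurable Y P := (hY.mono (ℱ.le k) le_rfl).aestronglyMeasurable
  set δ : ℕ → ℝ := fun n => Real.exp (B * t ^ 2) * (2 * B * |t| ^ 3 / √(a n) +
    (|t| + t ^ 2) * ((∫ ω, |∑ k ∈ Finset.range n, V k ω - l * a n| ∂P) / √(a n))) with hδ
  have hδ0 : Tendsto δ atTop (𝓝 0) := by
    have := ((hsqrt.const_div_atTop (2 * B * |t| ^ 3)).add
      (hdev.const_mul (|t| + t ^ 2))).const_mul (Real.exp (B * t ^ 2))
    simpa using this
  have hdiff : Tendsto (fun n => ∫ ω, Y ω * Complex.exp (t * normalizedCount N a l n ω * Complex.I) ∂P -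
      (∫ ω, Y ω * expMartingale N V (t / √(a n)) n ω ∂P) * E) atTop (𝓝 0) := by
    refine squeeze_zero_norm' ?_ hδ0
    filter_upwards [hB, ha.eventually_ge_atTop 1, ha.eventually_ge_atTop (t ^ 2)] with n hBn ha1 hat
    have hX := ((h.measurable_normalizedCount (a := a) (l := l) n).mono (ℱ.le n) le_rfl)
    have hW := (h.measurable_expMartingale (t / √(a n)) n).mono (ℱ.le n) le_rfl
    have hi1 : Integrable (fun ω => Y ω * Complex.exp (t * normalizedCount N a l n ω * Complex.I)) P := by
      refine Integrable.of_bound (hYm.mul (Measurable.aestronglyMeasurable (by fun_prop))) 1 ?_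
      filter_upwards [hY1] with ω hω
      rwa [norm_mul, norm_cexp_mul_I, mul_one]
    have hi2 : Integrable (fun ω => Y ω * expMartingale N V (t / √(a n)) n ω) P := by
      obtain ⟨K, hK⟩ := h.rate_bdd n
      refine Integrable.of_bound (hYm.mul hW.aestronglyMeasurable)
        (Real.exp ((t / √(a n)) ^ 2 / 2 * K)) ?_
      filter_upwards [hY1, hK] with ω hω hK
      rw [norm_mul]
      refine (mul_le_of_le_one_left (norm_nonneg _) hω).trans
        ((norm_expMartingale_le (h.sum_rate_nonneg n ω)).trans (Real.exp_le_exp.2 ?_))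
      gcongr
    rw [← integral_mul_const, ← integral_sub hi1 (hi2.mul_const _)]
    refine (norm_integral_le_of_norm_le (g := fun ω => Real.exp (B * t ^ 2) *
      (2 * B * |t| ^ 3 / √(a n) +
      (|t| + t ^ 2) * (|∑ k ∈ Finset.range n, V k ω - l * a n| / √(a n)))) ?_ ?_).trans_eq ?_
    · exact ((integrable_const _).add (((h.integrable_abs_sub n _).div_const _).const_mul _)).const_mul _
    · filter_upwards [hBn, hY1] with ω hω hYω
      have := h.norm_cexp_sub_expMartingale_le hl ha1 hat hω
      calc _ = ‖Y ω‖ * ‖Complex.exp (t * normalizedCount N a l n ω * Complex.I) -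
            E * expMartingale N V (t / √(a n)) n ω‖ := by
              rw [← norm_mul]; congr 1; ring
        _ ≤ 1 * _ := by gcongr; exact this
        _ = _ := one_mul _
    · rw [integral_const_mul, integral_add (integrable_const _)
        (((h.integrable_abs_sub n _).div_const _).const_mul _), integral_const_mul,
        integral_const, probReal_univ, one_smul, integral_div]
  have := hdiff.add hmain
  simpa using this

lemma tendsto_setIntegral_cexp {H : Set Ω} (hH : MeasurableSet H) (t : ℝ) :
    Tendsto (fun n => ∫ ω in H, Complex.exp (t * normalizedCount N a l n ω * Complex.I) ∂P) atTop
      (𝓝 (P.real H * Complex.exp (-(l * t ^ 2 / 2 : ℝ)))) := by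
  set g : Ω → ℝ := H.indicator fun _ => 1 with hg
  have hgi : Integrable g P := (integrable_const _).indicator hH
  set G : MeasurableSpace Ω := ⨆ n, ℱ n with hG
  have hGle : G ≤ mΩ := iSup_le fun n => ℱ.le n
  set φ : ℕ → Ω → ℂ := fun n ω => Complex.exp (t * normalizedCount N a l n ω * Complex.I) with hφ
  set E : ℂ := Complex.exp (-(l * t ^ 2 / 2 : ℝ)) with hE
  have hφG : ∀ n, Measurable[G] (φ n) := fun n => by
    have : Measurable[G] (normalizedCount N a l n) :=
      (h.measurable_normalizedCount n).mono (le_iSup (fun n => (ℱ n : MeasurableSpace Ω)) n) le_rfl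
    simp only [hφ]
    fun_prop
  have hφ1 : ∀ n ω, ‖φ n ω‖ ≤ 1 := fun n ω => (norm_cexp_mul_I _ _).le
  have hE1 : ‖E‖ ≤ 1 := by
    rw [hE, ← Complex.ofReal_neg, ← Complex.ofReal_exp, Complex.norm_real,
      Real.norm_of_nonneg (Real.exp_nonneg _), Real.exp_le_one_iff]
    have : 0 ≤ l * t ^ 2 / 2 := by positivity
    linarith
  -- the functional to be shown to vanish in the limit
  set T : (Ω → ℝ) → ℕ → ℂ := fun f n => ∫ ω, f ω • (φ n ω - E) ∂P with hT
  have hψi : ∀ (f : Ω → ℝ), Integrable f P → ∀ n, Integrable (fun ω => f ω • (φ n ω - E)) P := by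
    intro f hf n
    exact hf.smul_bdd 2 (((hφG n).mono hGle le_rfl).sub_const E).aestronglyMeasurable
      (ae_of_all _ fun ω => (norm_sub_le _ _).trans (by linarith [hφ1 n ω]))
  -- The `φ n` are measurable for `G`, so an arbitrary event enters only through its conditional
  -- probability given `G`. This gives stability over all events, not merely those of `G`.
  have hTG : ∀ n, T g n = T (P[g | G]) n := by
    intro n
    have hpull := condExp_bilin_of_stronglyMeasurable_left (μ := P) (m := G)
      (ContinuousLinearMap.lsmul ℝ ℝ (E := ℂ)).flip (f := fun ω => φ n ω - E) (g := g)
      ((hφG n).sub_const E).stronglyMeasurable (by simpa using hψi g hgi n) hgi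
    simp only [hT]
    rw [← integral_condExp hGle]
    refine integral_congr_ae ?_
    filter_upwards [hpull] with ω hω
    simpa using hω
  -- The bound does not depend on `n`: Lévy's upward theorem makes it small by the choice of `k`,
  -- and `n` tends to infinity afterwards.
  have hTsub : ∀ k n, ‖T (P[g | G]) n - T (P[g | ℱ k]) n‖ ≤
      2 * (eLpNorm (P[g | ℱ k] - P[g | G]) 1 P).toReal := by
    intro k n
    simp only [hT]
    rw [← integral_sub (hψi _ integrable_condExp n) (hψi _ integrable_condExp n)]
    refine (norm_integral_le_of_norm_le (g := fun ω => 2 * ‖(P[g | ℱ k] - P[g | G]) ω‖)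
      ((integrable_condExp.sub integrable_condExp).norm.const_mul _) (ae_of_all _ fun ω => ?_)).trans_eq ?_
    · rw [← sub_smul, norm_smul, Pi.sub_apply, norm_sub_rev, mul_comm]
      gcongr
      exact (norm_sub_le _ _).trans (by linarith [hφ1 n ω])
    · rw [integral_const_mul, integral_norm_eq_lintegral_enorm
        (integrable_condExp.sub integrable_condExp).aestronglyMeasurable, eLpNorm_one_eq_lintegral_enorm]
  have hTk : ∀ k, Tendsto (T (P[g | ℱ k])) atTop (𝓝 0) := by
    intro k
    have hY : Measurable[ℱ k] fun ω => ((P[g | ℱ k] ω : ℝ) : ℂ) :=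
      Complex.measurable_ofReal.comp stronglyMeasurable_condExp.measurable
    have hY1 : ∀ᵐ ω ∂P, ‖((P[g | ℱ k] ω : ℝ) : ℂ)‖ ≤ 1 := by
      have : ∀ᵐ ω ∂P, |P[g | ℱ k] ω| ≤ 1 := ae_bdd_abs_condExp_of_ae_bdd_abs (by
        refine ae_of_all _ fun ω => ?_
        by_cases hω : ω ∈ H <;> simp [hg, hω])
      filter_upwards [this] with ω hω
      simpa using hω
    have hlim := (h.tendsto_integral_mul_cexp ha hl hB hdev k hY hY1 t).sub_const
      ((∫ ω, ((P[g | ℱ k] ω : ℝ) : ℂ) ∂P) * E)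
    rw [sub_self] at hlim
    refine hlim.congr fun n => ?_
    simp only [hT]
    rw [← integral_mul_const, ← integral_sub]
    · refine integral_congr_ae (ae_of_all _ fun ω => ?_)
      simp only [Complex.real_smul, hφ]
      ring
    · have := (integrable_condExp (μ := P) (m := ℱ k) (f := g)).smul_bdd 1
        ((hφG n).mono hGle le_rfl).aestronglyMeasurable (ae_of_all _ (hφ1 n))
      exact this.congr (ae_of_all _ fun ω => by simp [hφ])
    · exact integrable_condExp.ofReal.mul_const _
  have hTg : Tendsto (T g) atTop (𝓝 0) := by
    rw [Metric.tendsto_atTop]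
    intro ε hε
    have hL := (ENNReal.tendsto_toReal ENNReal.zero_ne_top).comp
      (tendsto_eLpNorm_condExp (μ := P) (ℱ := ℱ) g)
    rw [ENNReal.toReal_zero] at hL
    obtain ⟨k, hk⟩ := (hL.eventually_lt_const (show (0 : ℝ) < ε / 4 by positivity)).exists
    obtain ⟨n₀, hn₀⟩ := (Metric.tendsto_atTop.1 (hTk k)) (ε / 2) (by positivity)
    refine ⟨n₀, fun n hn => ?_⟩
    have h1 := hn₀ n hn
    rw [dist_zero_right] at h1 ⊢
    have h2 := hTsub k n
    have h3 : (eLpNorm (P[g | ℱ k] - P[g | G]) 1 P).toReal < ε / 4 := hk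
    rw [hTG n]
    calc _ = ‖(T (P[g | G]) n - T (P[g | ℱ k]) n) + T (P[g | ℱ k]) n‖ := by rw [sub_add_cancel]
      _ ≤ _ := norm_add_le _ _
      _ < ε := by linarith
  have hfin := hTg.add_const (P.real H * E)
  rw [zero_add] at hfin
  refine hfin.congr fun n => ?_
  have hφm : Integrable (φ n) (P.restrict H) := Integrable.of_bound
    ((hφG n).mono hGle le_rfl).aestronglyMeasurable 1 (ae_of_all _ (hφ1 n))
  have h1 : T g n = ∫ ω in H, (φ n ω - E) ∂P := by
    simp only [hT]
    rw [← integral_indicator hH]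
    refine integral_congr_ae (ae_of_all _ fun ω => ?_)
    by_cases hω : ω ∈ H <;> simp [hg, hω]
  rw [h1, integral_sub hφm (integrable_const _), integral_const]
  simp [hφ, Measure.real]

/-- Stable central limit theorem for conditionally Poisson increments. -/
theorem convergesStably :
    ConvergesStably P (normalizedCount N a l) (Kernel.const Ω (gaussianReal 0 l.toNNReal)) :=
  convergesStably_gaussian
    (fun n => ((h.measurable_normalizedCount n).mono (ℱ.le n) le_rfl).aemeasurable) hl
    fun _ hH t => h.tendsto_setIntegral_cexp ha hl hB hdev hH t

end IsConditionallyPoisson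

lemma ConvergesStably.congr {Ω E : Type*} [MeasurableSpace Ω] [TopologicalSpace E]
    [MeasurableSpace E] {P : Measure Ω} {X Y : ℕ → Ω → E} {K : Kernel Ω E} [IsMarkovKernel K]
    (h : ConvergesStably P X K) (hXY : ∀ n, X n =ᵐ[P] Y n) : ConvergesStably P Y K := by
  refine ⟨fun n => (h.aemeasurable n).congr (hXY n), fun H hH hPH f => ?_⟩
  refine (h.tendsto H hH hPH f).congr fun n => integral_congr_ae ?_
  filter_upwards [cond_absolutelyContinuous.ae_eq (hXY n)] with ω hω
  rw [hω]

lemma limitRate_nonneg {α β c r : ℝ} (hα : 0 < α) (hβ0 : 0 ≤ β) (hβ1 : β < 1) (hc : -β < c)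
    (hr : 0 < r) : 0 ≤ limitRate α β c r := by
  rw [limitRate_eq (fun h => by linarith) r hr]
  have := rateConst_pos hα hβ1 hc
  have := growthFactor_nonneg hβ0
  positivity

lemma le_limit_of_tendsto {Ω : Type*} [MeasurableSpace Ω] {P : Measure Ω} [NeZero P]
    {R : ℕ → Ω → ℝ} {u r : ℝ} (hu : ∀ᵐ ω ∂P, ∀ n : ℕ, n * u ≤ totalWeight R n ω)
    (hmean : ∀ᵐ ω ∂P, Tendsto (fun n => meanWeight R n ω) atTop (𝓝 r)) : u ≤ r := by
  obtain ⟨ω, h1, h2⟩ := (hu.and hmean).exists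
  refine ge_of_tendsto h2 ?_
  filter_upwards [eventually_gt_atTop 0] with n hn
  rw [meanWeight, le_div_iff₀ (by exact_mod_cast hn), mul_comm]
  exact h1 n

/-! ### Verification of the hypotheses for the weighted Indian buffet process. -/

namespace IsWeightedIBP

variable {Ω 𝓧 : Type*} [MeasurableSpace Ω] {P : Measure Ω} [IsProbabilityMeasure P]
  [MeasurableSpace 𝓧]
  {m : Measure 𝓧}
  {α β c : ℝ} {M : ℕ → Ω → Measure 𝓧} {R : ℕ → Ω → ℝ}
  (h : IsWeightedIBP P m α β c M R)
include h

omit [IsProbabilityMeasure P] in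
/-- The filtration of the process. -/
lemma exists_filtration : ∃ ℱ : Filtration ℕ ‹MeasurableSpace Ω›, ∀ n, ℱ n = history M R n :=
  ⟨⟨history M R, history_mono, h.history_le⟩, fun _ => rfl⟩

omit [IsProbabilityMeasure P] in
lemma exists_lower_bound : ∃ u > 0, ∀ᵐ ω ∂P, ∀ n : ℕ, n * u ≤ totalWeight R n ω := by
  obtain ⟨u, hu, hR⟩ := h.lower_bound
  refine ⟨u, (le_max_right β 0).trans_lt hu, ?_⟩
  filter_upwards [ae_all_iff.2 hR] with ω hω n
  calc n * u = ∑ i ∈ Finset.range n, u := by simp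
    _ ≤ _ := Finset.sum_le_sum fun i _ => hω i

omit [IsProbabilityMeasure P] in
lemma ae_sum_rate_eq : ∀ᵐ ω ∂P, ∀ n,
    ∑ k ∈ Finset.range n, dishRateMax α β c (totalWeight R k ω) =
      ∑ k ∈ Finset.range n, dishRate α β c (totalWeight R k ω) := by
  filter_upwards [h.ae_newDishRate_eq] with ω hω n
  exact Finset.sum_congr rfl fun k _ => (hω k).symm

omit [IsProbabilityMeasure P] in
lemma measurable_meanWeight (n : ℕ) : Measurable (meanWeight R n) :=
  (Finset.measurable_fun_sum _ fun i _ => h.measurable_weight i).div_const _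

variable (hα : 0 < α) (hβ0 : 0 ≤ β) (hβ1 : β < 1) (hc : -β < c)
include hα hβ0 hβ1 hc

omit [IsProbabilityMeasure P] in
lemma exists_sum_rate_le : ∃ B > 0, ∀ n ≥ 1, ∀ᵐ ω ∂P,
    ∑ k ∈ Finset.range n, dishRateMax α β c (totalWeight R k ω) ≤ B * (1 + growth β n) := by
  obtain ⟨u, hu, hT⟩ := h.exists_lower_bound
  obtain ⟨B, hB, hle⟩ := exists_sum_dishRate_le hα hβ0 hβ1 hc hu
  refine ⟨B, hB, fun n hn => ?_⟩
  filter_upwards [hT, h.ae_sum_rate_eq] with ω hω hsum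
  rw [hsum]
  exact hle _ (by simp [totalWeight]) hω n hn

lemma isConditionallyPoisson [MeasurableSingletonClass 𝓧] [CountablyGenerated 𝓧]
    [IsProbabilityMeasure m] (hm : ∀ x, m {x} = 0)
    {ℱ : Filtration ℕ ‹MeasurableSpace Ω›} (hℱ : ∀ n, ℱ n = history M R n) :
    IsConditionallyPoisson P ℱ (newDishes M)
      (fun k ω => dishRateMax α β c (totalWeight R k ω)) where
  measurable_count k := by rw [hℱ]; exact measurable_newDishes k
  measurable_rate k := by
    rw [hℱ]
    exact (measurable_dishRateMax α β c hβ1 hc).comp (measurable_totalWeight_history k)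
  rate_nonneg k ω := (dishRate_pos hα hβ1 hc (le_max_right _ _)).le
  integral_cexp k Z C hZ hC s := by
    rw [hℱ] at hZ
    rw [h.integral_cexp_newDishes hm hα hβ0 hβ1 hc k hZ hC s]
    refine integral_congr_ae ?_
    filter_upwards [h.ae_newDishRate_eq] with ω hω
    rw [hω k]
  rate_bdd n := by
    rcases n.eq_zero_or_pos with rfl | hn
    · exact ⟨0, by simp⟩
    · obtain ⟨B, -, hB⟩ := h.exists_sum_rate_le hα hβ0 hβ1 hc
      exact ⟨_, hB n hn⟩

lemma tendsto_integral_abs_sum_rate_sub {r : ℝ}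
    (hmean : ∀ᵐ ω ∂P, Tendsto (fun n => meanWeight R n ω) atTop (𝓝 r))
    (hrate : Tendsto
      (fun n : ℕ => (∑ j ∈ Finset.Icc 1 n, ENNReal.ofReal ((j : ℝ) ^ (β - 1)) *
          ∫⁻ ω, ENNReal.ofReal |meanWeight R j ω - r| ∂P) / ENNReal.ofReal (√(growth β n)))
      atTop (𝓝 0)) :
    Tendsto (fun n : ℕ => (∫ ω, |∑ k ∈ Finset.range n, dishRateMax α β c (totalWeight R k ω) -
      limitRate α β c r * growth β n| ∂P) / √(growth β n)) atTop (𝓝 0) := by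
  obtain ⟨u, hu, hT⟩ := h.exists_lower_bound
  have hr := le_limit_of_tendsto hT hmean
  obtain ⟨B, hB, hle⟩ := exists_abs_sum_dishRate_sub_le hα hβ0 hβ1 hc hu hr
    (fun h => by linarith)
  have hgrowth := tendsto_growth hβ0
  have hsqrt : Tendsto (fun n => √(growth β n)) atTop atTop := Real.tendsto_sqrt_atTop.comp hgrowth
  set S : ℕ → Ω → ℝ := fun n ω => |∑ k ∈ Finset.range n, dishRateMax α β c (totalWeight R k ω) -
      limitRate α β c r * growth β n| with hS
  have hSm : ∀ n, Measurable (S n) := fun n => by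
    have : Measurable fun ω => ∑ k ∈ Finset.range n, dishRateMax α β c (totalWeight R k ω) :=
      Finset.measurable_fun_sum _ fun k _ => (measurable_dishRateMax α β c hβ1 hc).comp
        ((measurable_totalWeight_history (M := M) k).mono (h.history_le k) le_rfl)
    exact (this.sub_const _).norm
  -- The estimate is kept in `ℝ≥0∞`, so no integrability of the weights is needed; the passage to
  -- real integrals comes after the limit.
  have hbound : ∀ n ≥ 1, ∫⁻ ω, ENNReal.ofReal (S n ω) ∂P ≤ ENNReal.ofReal B * (1 +
      ∑ j ∈ Finset.Icc 1 n, ENNReal.ofReal ((j : ℝ) ^ (β - 1)) *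
          ∫⁻ ω, ENNReal.ofReal |meanWeight R j ω - r| ∂P) := by
    intro n hn
    have hmeas : ∀ j, Measurable fun ω => ENNReal.ofReal |meanWeight R j ω - r| := fun j =>
      ((h.measurable_meanWeight j).sub_const r).norm.ennreal_ofReal
    have : ∀ᵐ ω ∂P, ENNReal.ofReal (S n ω) ≤ ENNReal.ofReal B * (1 +
        ∑ j ∈ Finset.Icc 1 n, ENNReal.ofReal ((j : ℝ) ^ (β - 1)) *
          ENNReal.ofReal |meanWeight R j ω - r|) := by
      filter_upwards [hT, h.ae_sum_rate_eq] with ω hω hsum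
      have h1 := hle (fun k => totalWeight R k ω) (by simp [totalWeight]) hω n hn
      rw [← hsum] at h1
      refine (ENNReal.ofReal_le_ofReal h1).trans_eq ?_
      rw [ENNReal.ofReal_mul hB.le, ENNReal.ofReal_add zero_le_one
        (Finset.sum_nonneg fun j _ => by positivity), ENNReal.ofReal_one,
        ENNReal.ofReal_sum_of_nonneg (fun j _ => by positivity)]
      congr 2
      exact Finset.sum_congr rfl fun j _ => ENNReal.ofReal_mul (by positivity)
    refine (lintegral_mono_ae this).trans_eq ?_
    have hsumm : Measurable fun ω => ∑ j ∈ Finset.Icc 1 n, ENNReal.ofReal ((j : ℝ) ^ (β - 1)) *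
          ENNReal.ofReal |meanWeight R j ω - r| :=
      Finset.measurable_fun_sum _ fun j _ => (hmeas j).const_mul _
    rw [lintegral_const_mul _ (hsumm.const_add 1), lintegral_add_left measurable_const,
      lintegral_const, measure_univ, one_mul,
      lintegral_finsetSum _ fun j _ => (hmeas j).const_mul _]
    congr 2
    exact Finset.sum_congr rfl fun j _ => lintegral_const_mul _ (hmeas j)
  have hlim : Tendsto (fun n => (∫⁻ ω, ENNReal.ofReal (S n ω) ∂P) /
      ENNReal.ofReal (√(growth β n))) atTop (𝓝 0) := by
    have h1 : Tendsto (fun n => ENNReal.ofReal B * (1 / ENNReal.ofReal (√(growth β n)) +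
        (∑ j ∈ Finset.Icc 1 n, ENNReal.ofReal ((j : ℝ) ^ (β - 1)) *
          ∫⁻ ω, ENNReal.ofReal |meanWeight R j ω - r| ∂P) / ENNReal.ofReal (√(growth β n))))
        atTop (𝓝 0) := by
      have h2 : Tendsto (fun n => 1 / ENNReal.ofReal (√(growth β n))) atTop (𝓝 0) := by
        simp only [one_div]
        rw [← ENNReal.inv_top, tendsto_inv_iff]
        exact ENNReal.tendsto_ofReal_atTop.comp hsqrt
      simpa using ENNReal.Tendsto.const_mul (h2.add hrate) (Or.inr ENNReal.ofReal_ne_top)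
    refine tendsto_of_tendsto_of_tendsto_of_le_of_le' tendsto_const_nhds h1
      (Eventually.of_forall fun _ => zero_le) ?_
    filter_upwards [eventually_ge_atTop 1] with n hn
    rw [← ENNReal.add_div, ← mul_div_assoc]
    exact ENNReal.div_le_div_right (hbound n hn) _
  have hreal := (ENNReal.tendsto_toReal ENNReal.zero_ne_top).comp hlim
  rw [ENNReal.toReal_zero] at hreal
  refine hreal.congr fun n => ?_
  rw [Function.comp_apply, ENNReal.toReal_div, ENNReal.toReal_ofReal (Real.sqrt_nonneg _),
    integral_eq_lintegral_of_nonneg_ae (ae_of_all _ fun ω => abs_nonneg _)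
      (hSm n).aestronglyMeasurable]

end IsWeightedIBP

end WeightedIBP

end

open WeightedIBP in
theorem mainTheorem2 {Ω 𝓧 : Type*} [MeasurableSpace Ω] (P : Measure Ω) [IsProbabilityMeasure P]
    [MetricSpace 𝓧] [TopologicalSpace.SeparableSpace 𝓧] [MeasurableSpace 𝓧] [BorelSpace 𝓧]
    (m : Measure 𝓧) [IsProbabilityMeasure m] (hm : ∀ x, m {x} = 0)
    (α β c : ℝ) (hα : 0 < α) (hβ0 : 0 ≤ β) (hβ1 : β < 1) (hc : -β < c)
    (M : ℕ → Ω → Measure 𝓧) (R : ℕ → Ω → ℝ) (hIBP : IsWeightedIBP P m α β c M R)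
    (r : ℝ)
    (hmean : ∀ᵐ ω ∂P, Tendsto (fun n => meanWeight R n ω) atTop (𝓝 r))
    (hrate : Tendsto
      (fun n : ℕ => (∑ j ∈ Finset.Icc 1 n, ENNReal.ofReal ((j : ℝ) ^ (β - 1)) *
          ∫⁻ ω, ENNReal.ofReal |meanWeight R j ω - r| ∂P) / ENNReal.ofReal (√(growth β n)))
      atTop (𝓝 0)) :
    ConvergesStably P
      (fun n ω => √(growth β n) * ((numDishes M n ω : ℝ) / growth β n - limitRate α β c r))
      (Kernel.const Ω (gaussianReal 0 (limitRate α β c r).toNNReal)) := by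
  -- Second countability makes the Borel σ-field countably generated, as the partitions require.
  have : SecondCountableTopology 𝓧 := UniformSpace.secondCountable_of_separable 𝓧
  obtain ⟨ℱ, hℱ⟩ := hIBP.exists_filtration
  obtain ⟨B, -, hB⟩ := hIBP.exists_sum_rate_le hα hβ0 hβ1 hc
  obtain ⟨u, hu, hT⟩ := hIBP.exists_lower_bound
  have hl := limitRate_nonneg hα hβ0 hβ1 hc (hu.trans_le (le_limit_of_tendsto hT hmean))
  refine ((hIBP.isConditionallyPoisson hα hβ0 hβ1 hc hm hℱ).convergesStably (tendsto_growth hβ0) hl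
    ((eventually_ge_atTop 1).mono hB)
    (hIBP.tendsto_integral_abs_sum_rate_sub hα hβ0 hβ1 hc hmean hrate)).congr fun n => ?_
  -- The dish count equals the sum of the measurable `newDishes` where all the `M k` are simple,
  -- hence almost surely.
  filter_upwards [hIBP.ae_isSimplePoint hm hα hβ0 hβ1 hc] with ω hω
  rw [IsConditionallyPoisson.normalizedCount, numDishes_eq_sum fun i _ => hω i]
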